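/- Let $d\ge 2$, let $\mathcal X\subseteq\mathbb R^d$ be open, and let $r:\mathcal X\to\mathbb R^d$ be continuously differentiable and such that, for every $\zeta\in\mathcal X$, the problem $x'(t)=r(x(t))$, $x(0)=\zeta$, has a solution $\phi(\zeta,\cdot)$ defined on all of $\mathbb R$ with values in $\mathcal X$ (it is then unique and $\mathcal C^1$). On a probability space, let $(T_n,M_n)_{n\ge0}$ be random variables with values in $\mathbb R\times\mathcal X$ such that almost surely $0=T_0<T_1\le T_2\le\cdots$ and $T_n\to\infty$, and such that the expected number of jump times $T_n$, $n\ge1$, in any bounded interval is finite. Let $X$ be the piecewise smooth process given by $X(t)=\phi(M_n,t-T_n)$ for $T_n\le t<T_{n+1}$, and assume that for every $t\ge0$ the random vector $X(t)$ has a density $p_{X(t)}$ with respect to Lebesgue measure on $\mathbb R^d$. Let $\mathcal D\subseteq\mathcal X$ be a bounded open set with boundary $S=\partial\mathcal D\subseteq\mathcal X$, and let $\rho:\mathbb R^d\to\mathbb R$ be a $\mathcal C^1$ function with $\mathcal D=\{x\in\mathcal X:\rho(x)<0\}$, $\mathcal X\setminus\overline{\mathcal D}=\{x\in\mathcal X:\rho(x)>0\}$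 and $\nabla\rho\ne0$ on $S$; put $\nu=\nabla\rho/\|\nabla\rho\|$, the outward unit normal on $S$. A path $Z$ has a continuous crossing of $S$ at time $s>0$ if $Z(s^-)=Z(s)\in S$ and, for some $\delta>0$, $Z(t)\notin S$ for all $t\in(s-\delta,s+\delta)\setminus\{s\}$. Let $H\ge0$, let $c_S^Z(H)\in\mathbb N\cup\{\infty\}$ be the number of continuous crossings of $S$ by $Z$ within $[0,H]$, and let $C_S(H)=\mathbb E[c_S^X(H)]$. Assume that 1. $(r(x),\nu(x))\ne0$ for all $x\in S$, and $\sup_{x\in\mathcal X}c_S^{\phi(x,\cdot)}(H)<\infty$; 2. almost surely, $X$ does not jump from or to $S$: if $X(t^-)\ne X(t)$, then $X(t^-)\notin S$ and $X(t)\notin S$; 3. $(x,t)\mapsto p_{X(t)}(x)$ is continuous on $V\times[0,H]$ for some open set $V\supseteq S$. If $p_{X(0)}$ is a stationary density for $X$, that is, if $p_{X(0)}$ is a density of $X(t)$ for every $t\ge0$, then $c_S^X(H)$ is a random variable (up to a null set), $x\mapsto|(r(x),\nu(x))|\,p_{X(0)}(x)$ is integrable on $S$ with respect to $\sigma_{d-1}$,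 and $$C_S(H)=H\int_S|(r(x),\nu(x))|\,p_{X(0)}(x)\,\sigma_{d-1}(\mathrm dx)<\infty,$$ where $\sigma_{d-1}$ is the surface measure of $S$, that is, the $(d-1)$-dimensional Hausdorff measure normalized so as to agree with Lebesgue measure on $\mathbb R^{d-1}$. -/

import Mathlib

open MeasureTheory Set Filter Topology
open scoped RealInnerProductSpace ENNReal

/-- `φ` is the flow on `𝒳` of the vector field `r`: for every `ζ ∈ 𝒳`, `φ ζ` is a solution,
defined on all of `ℝ` and with values in `𝒳`, of `x' = r(x)`, `x(0) = ζ`.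
When `r` is continuously differentiable on the open set `𝒳`, such a solution is unique and
continuously differentiable, and the flow property `φ ζ (t + s) = φ (φ ζ t) s` follows. -/
structure IsFlowOf {d : ℕ} (𝒳 : Set (EuclideanSpace ℝ (Fin d)))
    (r : EuclideanSpace ℝ (Fin d) → EuclideanSpace ℝ (Fin d))
    (φ : EuclideanSpace ℝ (Fin d) → ℝ → EuclideanSpace ℝ (Fin d)) : Prop where
  init : ∀ ζ ∈ 𝒳, φ ζ 0 = ζ
  mem : ∀ ζ ∈ 𝒳, ∀ t : ℝ, φ ζ t ∈ 𝒳
  hasDerivAt : ∀ ζ ∈ 𝒳, ∀ t : ℝ, HasDerivAt (φ ζ) (r (φ ζ t)) t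

/-- `(T n, M n)` is a marked point process with marks in `𝒳`: almost surely
`0 = T 0 < T 1 ≤ T 2 ≤ …` and `T n → ∞`. -/
structure IsMarkedPointProcess {Ω : Type*} [MeasurableSpace Ω] (P : Measure Ω) {d : ℕ}
    (𝒳 : Set (EuclideanSpace ℝ (Fin d))) (T : ℕ → Ω → ℝ)
    (M : ℕ → Ω → EuclideanSpace ℝ (Fin d)) : Prop where
  measurable_time : ∀ n, Measurable (T n)
  measurable_mark : ∀ n, Measurable (M n)
  mark_mem : ∀ n ω, M n ω ∈ 𝒳
  time_zero : ∀ᵐ ω ∂P, T 0 ω = 0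
  time_one_pos : ∀ᵐ ω ∂P, 0 < T 1 ω
  time_mono : ∀ᵐ ω ∂P, Monotone fun n => T n ω
  time_tendsto : ∀ᵐ ω ∂P, Tendsto (fun n => T n ω) atTop atTop

/-- The number of jump times (other than the starting time `T 0`) in `[0, u]`. -/
noncomputable def jumpTimeCount {Ω : Type*} (T : ℕ → Ω → ℝ) (u : ℝ) (ω : Ω) : ℕ∞ :=
  {t : ℝ | t ∈ Icc 0 u ∧ ∃ n : ℕ, 1 ≤ n ∧ T n ω = t}.encard

/-- The index of the last jump up to time `t`, that is, the largest `n` with `T n ω ≤ t`. -/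
noncomputable def lastJumpIndex {Ω : Type*} (T : ℕ → Ω → ℝ) (t : ℝ) (ω : Ω) : ℕ :=
  sSup {n : ℕ | T n ω ≤ t}

/-- The piecewise smooth process with flow `φ` and marked point process `(T n, M n)`:
`X t = φ (M n) (t - T n)` for `T n ≤ t < T (n + 1)`. Only times `t ≥ 0` are meaningful. -/
noncomputable def piecewiseSmoothProcess {Ω : Type*} {d : ℕ}
    (φ : EuclideanSpace ℝ (Fin d) → ℝ → EuclideanSpace ℝ (Fin d))
    (T : ℕ → Ω → ℝ) (M : ℕ → Ω → EuclideanSpace ℝ (Fin d)) (t : ℝ) (ω : Ω) :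
    EuclideanSpace ℝ (Fin d) :=
  φ (M (lastJumpIndex T t ω) ω) (t - T (lastJumpIndex T t ω) ω)

/-- `ρ` is a `C¹` defining function for the bounded open set `D ⊆ 𝒳`, the boundary of which
lies in `𝒳`. -/
structure IsDefiningFunction {d : ℕ} (𝒳 D : Set (EuclideanSpace ℝ (Fin d)))
    (ρ : EuclideanSpace ℝ (Fin d) → ℝ) : Prop where
  isOpen : IsOpen D
  isBounded : Bornology.IsBounded D
  frontier_subset : frontier D ⊆ 𝒳
  contDiff : ContDiff ℝ 1 ρ
  neg_iff : D = {x ∈ 𝒳 | ρ x < 0}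
  pos_iff : 𝒳 \ closure D = {x ∈ 𝒳 | 0 < ρ x}
  gradient_ne_zero : ∀ x ∈ frontier D, gradient ρ x ≠ 0

/-- The field of unit normals `∇ρ / ‖∇ρ‖`. -/
noncomputable def unitNormal {d : ℕ} (ρ : EuclideanSpace ℝ (Fin d) → ℝ)
    (x : EuclideanSpace ℝ (Fin d)) : EuclideanSpace ℝ (Fin d) :=
  ‖gradient ρ x‖⁻¹ • gradient ρ x

/-- The path `Z` has a continuous crossing of `S` at time `s > 0`: `Z(s⁻) = Z(s) ∈ S`, and `Z`
is outside `S` at all other times of a neighbourhood of `s`. -/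
def HasContinuousCrossing {d : ℕ} (Z : ℝ → EuclideanSpace ℝ (Fin d))
    (S : Set (EuclideanSpace ℝ (Fin d))) (s : ℝ) : Prop :=
  0 < s ∧ Tendsto Z (𝓝[<] s) (𝓝 (Z s)) ∧ Z s ∈ S ∧
    ∃ δ > 0, ∀ t ∈ Ioo (s - δ) (s + δ), t ≠ s → Z t ∉ S

/-- The number of continuous crossings of `S` by the path `Z` within `[0, H]`. -/
noncomputable def crossingCount {d : ℕ} (Z : ℝ → EuclideanSpace ℝ (Fin d))
    (S : Set (EuclideanSpace ℝ (Fin d))) (H : ℝ) : ℕ∞ :=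
  {s : ℝ | s ∈ Icc 0 H ∧ HasContinuousCrossing Z S s}.encard

/-- The path `Z` does not jump from or to `S`: wherever its left limit differs from its value,
neither of the two is in `S`. -/
def NoJumpFromOrTo {d : ℕ} (Z : ℝ → EuclideanSpace ℝ (Fin d))
    (S : Set (EuclideanSpace ℝ (Fin d))) : Prop :=
  ∀ t > 0, ∀ z, Tendsto Z (𝓝[<] t) (𝓝 z) → z ≠ Z t → z ∉ S ∧ Z t ∉ S

/-- The function `q` is a probability density of the random vector `Z` with respect to Lebesgue
measure. -/
structure HasDensity {Ω : Type*} [MeasurableSpace Ω] (P : Measure Ω) {d : ℕ}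
    (Z : Ω → EuclideanSpace ℝ (Fin d)) (q : EuclideanSpace ℝ (Fin d) → ℝ) : Prop where
  aemeasurable : AEMeasurable Z P
  measurable : Measurable q
  nonneg : ∀ x, 0 ≤ q x
  map_eq : P.map Z = volume.withDensity fun x => ENNReal.ofReal (q x)

/-- `q` is a stationary density for the process `X`: it is a density of `X t` for all `t ≥ 0`. -/
def IsStationaryDensity {Ω : Type*} [MeasurableSpace Ω] (P : Measure Ω) {d : ℕ}
    (X : ℝ → Ω → EuclideanSpace ℝ (Fin d)) (q : EuclideanSpace ℝ (Fin d) → ℝ) : Prop :=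
  ∀ t : ℝ, 0 ≤ t → HasDensity P (X t) q

/-!
The formula is proved by the Kac–Rice method. With `F = ⟪∇ρ, r⟫`, which is the derivative of `ρ`
along the flow, and a continuous cutoff `χ` equal to `1` on `S`, the smoothed crossing number of a
path `Z`, `(2δ)⁻¹ ∫_{[0, H]} χ(Z t) |F(Z t)| 1{|ρ(Z t)| < δ} dt`, is computed in two ways as
`δ → 0`.

*Along paths.* By transversality, `ρ ∘ Z` is strictly monotone near each visit to `S`, so a change
of variables shows that such a visit contributes exactly `1` for small `δ`; since the path does not
jump from or to `S`, and almost surely is outside `S` at the times `0` and `H`, every visit is a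
continuous crossing and all other times contribute nothing (`tendsto_crossingCount`). Near `S` the
flow has bounded speed, so on each smooth piece `ρ ∘ Z` is injective along visits to the support of
`χ` during short periods of a fixed length; this bounds the smoothed crossing number by a constant
times one plus the number of jump times (`IsGoodTimeSequence.lintegral_smoothed_crossings_le`), and
dominated convergence gives the convergence of expectations to the expected number of crossings.

*In space.* By Tonelli's theorem and stationarity, the expectation of the smoothed crossing number
is `H` times `(2δ)⁻¹ ∫_{|ρ| < δ} χ |F| p₀ = (2δ)⁻¹ ∫_{|ρ| < δ} h ‖∇ρ‖` with `h = χ |⟪r, ν⟫| p₀`,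
and this tends to `∫_S h dσ` (`tendsto_band_integral`). To see the latter near a point `x₀` of `S`,
integrate over the lines parallel to `e = ν(x₀)`: the one-dimensional argument used for paths
applies on each line and yields an integral over the projection of `S` along `e`. On a small ball
`‖∇ρ‖` and `∂ρ/∂e` agree up to a factor close to one, and so do surface measure and Lebesgue
measure of the projection, because the projection is bi-Lipschitz on `S` with constants close to
one; a partition of unity globalizes this. Finiteness of the surface measure of `S` also shows that
`S` is a Lebesgue null set, so that `X 0` and `X H` are almost surely outside `S`.
-/

/-! ### Smoothed counting of zeros on the line -/

/-- The normalized indicator of the band `(-δ, δ)`, an approximation of the Dirac mass at `0`. -/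
noncomputable def bandKernel (δ v : ℝ) : ℝ≥0∞ :=
  (Ioo (-δ) δ).indicator (fun _ => ENNReal.ofReal (2 * δ)⁻¹) v

lemma measurable_bandKernel (δ : ℝ) : Measurable (bandKernel δ) :=
  measurable_const.indicator measurableSet_Ioo

lemma bandKernel_of_le {δ v : ℝ} (h : δ ≤ |v|) : bandKernel δ v = 0 := by
  refine indicator_of_notMem (fun hv => ?_) _
  exact absurd (abs_lt.2 hv) (not_lt.2 h)

lemma bandKernel_neg (δ v : ℝ) : bandKernel δ (-v) = bandKernel δ v := by
  simp only [bandKernel, indicator, mem_Ioo]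
  congr 1
  exact propext ⟨fun h => ⟨by linarith [h.2], by linarith [h.1]⟩,
    fun h => ⟨by linarith [h.2], by linarith [h.1]⟩⟩

lemma lintegral_bandKernel {δ : ℝ} (hδ : 0 < δ) : ∫⁻ v, bandKernel δ v = 1 := by
  unfold bandKernel
  rw [lintegral_indicator measurableSet_Ioo, setLIntegral_const, Real.volume_Ioo,
    ← ENNReal.ofReal_mul (by positivity)]
  rw [show (2 * δ)⁻¹ * (δ - -δ) = 1 by field_simp; ring, ENNReal.ofReal_one]

/-- On a set where `u` is injective, the smoothed number of zeros of `u` is at most one. -/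
lemma lintegral_abs_deriv_mul_bandKernel_le {u u' : ℝ → ℝ} {s : Set ℝ} (hs : MeasurableSet s)
    (hu : ∀ x ∈ s, HasDerivWithinAt u (u' x) s x) (hinj : InjOn u s) {δ : ℝ} (hδ : 0 < δ) :
    ∫⁻ x in s, ENNReal.ofReal |u' x| * bandKernel δ (u x) ≤ 1 := by
  rw [← lintegral_image_eq_lintegral_abs_deriv_mul hs hu hinj (bandKernel δ)]
  exact (setLIntegral_le_lintegral _ _).trans (lintegral_bandKernel hδ).le

lemma lintegral_abs_deriv_mul_bandKernel_eq {u u' : ℝ → ℝ} {s : Set ℝ} (hs : MeasurableSet s)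
    (hu : ∀ x ∈ s, HasDerivWithinAt u (u' x) s x) (hinj : InjOn u s) {δ : ℝ} (hδ : 0 < δ)
    (hsub : Ioo (-δ) δ ⊆ u '' s) :
    ∫⁻ x in s, ENNReal.ofReal |u' x| * bandKernel δ (u x) = 1 := by
  rw [← lintegral_image_eq_lintegral_abs_deriv_mul hs hu hinj (bandKernel δ),
    ← lintegral_bandKernel hδ]
  refine setLIntegral_eq_of_support_subset ?_
  refine fun v hv => hsub ?_
  by_contra h
  exact hv (indicator_of_notMem h _)

/-- Around a nondegenerate zero `s₀` of an increasing function `u`, the measures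
`|u'| bandKernel δ (u)` concentrate at `s₀` with total mass one. -/
lemma tendsto_lintegral_bandKernel_of_pos {u u' : ℝ → ℝ} {w : ℝ → ℝ≥0∞} {s₀ η : ℝ} (hη : 0 < η)
    (hu : ∀ t ∈ Ioo (s₀ - η) (s₀ + η), HasDerivAt u (u' t) t)
    (hu' : ∀ t ∈ Ioo (s₀ - η) (s₀ + η), 0 < u' t) (h0 : u s₀ = 0) (hw : ContinuousAt w s₀) :
    Tendsto (fun δ => ∫⁻ t in Ioo (s₀ - η) (s₀ + η),
      w t * (ENNReal.ofReal |u' t| * bandKernel δ (u t))) (𝓝[>] 0) (𝓝 (w s₀)) := by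
  set I := Ioo (s₀ - η) (s₀ + η) with hI
  have hcont : ContinuousOn u I := fun t ht => (hu t ht).continuousAt.continuousWithinAt
  have hmono : StrictMonoOn u I := by
    refine strictMonoOn_of_deriv_pos (convex_Ioo _ _) hcont fun t ht => ?_
    rw [interior_Ioo] at ht
    rw [(hu t ht).deriv]; exact hu' t ht
  have hs₀ : s₀ ∈ I := ⟨by linarith, by linarith⟩
  -- for small `δ` the mass sits in any prescribed neighbourhood of `s₀`, and equals one
  have key : ∀ b, 0 < b → b < η → ∀ᶠ δ in 𝓝[>] (0 : ℝ),
      (∀ t ∈ I, t ∉ Ioo (s₀ - b) (s₀ + b) → bandKernel δ (u t) = 0) ∧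
      ∫⁻ t in Ioo (s₀ - b) (s₀ + b), ENNReal.ofReal |u' t| * bandKernel δ (u t) = 1 := by
    intro b hb hbη
    have hb1 : s₀ - b / 2 ∈ I := ⟨by linarith, by linarith⟩
    have hb2 : s₀ + b / 2 ∈ I := ⟨by linarith, by linarith⟩
    have hn : u (s₀ - b / 2) < 0 := h0 ▸ hmono hb1 hs₀ (by linarith)
    have hp : 0 < u (s₀ + b / 2) := h0 ▸ hmono hs₀ hb2 (by linarith)
    have hsub : Ioo (s₀ - b) (s₀ + b) ⊆ I := Ioo_subset_Ioo (by linarith) (by linarith)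
    have hc : 0 < min (-u (s₀ - b / 2)) (u (s₀ + b / 2)) := lt_min (by linarith) hp
    filter_upwards [Ioo_mem_nhdsGT hc] with δ hδ
    have h1 := lt_of_lt_of_le hδ.2 (min_le_left _ _)
    have h2 := lt_of_lt_of_le hδ.2 (min_le_right _ _)
    refine ⟨fun t ht htb => bandKernel_of_le ?_, ?_⟩
    · by_cases hlt : t ≤ s₀ - b / 2
      · have := hmono.monotoneOn ht hb1 hlt
        rw [abs_of_neg (by linarith)]; linarith
      · have hge : s₀ + b / 2 ≤ t := by
          by_contra hcon
          exact htb ⟨by linarith, by linarith⟩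
        have := hmono.monotoneOn hb2 ht hge
        rw [abs_of_pos (by linarith)]; linarith
    · refine lintegral_abs_deriv_mul_bandKernel_eq measurableSet_Ioo
        (fun t ht => (hu t (hsub ht)).hasDerivWithinAt) (hmono.injOn.mono hsub) hδ.1 ?_
      have hIcc : Icc (s₀ - b / 2) (s₀ + b / 2) ⊆ Ioo (s₀ - b) (s₀ + b) :=
        Icc_subset_Ioo (by linarith) (by linarith)
      have := intermediate_value_Icc (by linarith : s₀ - b / 2 ≤ s₀ + b / 2)
        (hcont.mono (hIcc.trans hsub))
      intro v hv
      exact image_mono hIcc (this ⟨by linarith [hv.1], by linarith [hv.2]⟩)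
  have hrestr : ∀ b, b < η → ∀ δ,
      (∀ t ∈ I, t ∉ Ioo (s₀ - b) (s₀ + b) → bandKernel δ (u t) = 0) →
      ∫⁻ t in I, w t * (ENNReal.ofReal |u' t| * bandKernel δ (u t)) =
      ∫⁻ t in Ioo (s₀ - b) (s₀ + b), w t * (ENNReal.ofReal |u' t| * bandKernel δ (u t)) := by
    intro b hbη δ h
    have hsub : Ioo (s₀ - b) (s₀ + b) ⊆ I := Ioo_subset_Ioo (by linarith) (by linarith)
    rw [← lintegral_indicator measurableSet_Ioo, ← lintegral_indicator measurableSet_Ioo]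
    refine lintegral_congr fun t => ?_
    by_cases htb : t ∈ Ioo (s₀ - b) (s₀ + b)
    · rw [indicator_of_mem htb, indicator_of_mem (hsub htb)]
    · rw [indicator_of_notMem htb]
      by_cases ht : t ∈ I
      · rw [indicator_of_mem ht, h t ht htb]; simp
      · rw [indicator_of_notMem ht]
  have hnear : ∀ A ∈ 𝓝 s₀, ∃ b, 0 < b ∧ b < η ∧ Ioo (s₀ - b) (s₀ + b) ⊆ A := by
    intro A hA
    obtain ⟨ε, hε, hball⟩ := Metric.mem_nhds_iff.1 hA
    refine ⟨min ε (η / 2), by positivity, (min_le_right _ _).trans_lt (by linarith), ?_⟩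
    rw [Real.ball_eq_Ioo] at hball
    exact (Ioo_subset_Ioo (by linarith [min_le_left ε (η / 2)])
      (by linarith [min_le_left ε (η / 2)])).trans hball
  refine tendsto_order.2 ⟨fun c hc => ?_, fun c hc => ?_⟩
  · obtain ⟨c', hc1, hc2⟩ := exists_between hc
    obtain ⟨b, hb, hbη, hbA⟩ := hnear _ (hw.eventually (lt_mem_nhds hc2))
    filter_upwards [key b hb hbη] with δ hδ
    rw [hrestr b hbη δ hδ.1]
    refine hc1.trans_le ?_
    calc c' = c' * ∫⁻ t in Ioo (s₀ - b) (s₀ + b),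
          ENNReal.ofReal |u' t| * bandKernel δ (u t) := by rw [hδ.2, mul_one]
      _ ≤ ∫⁻ t in Ioo (s₀ - b) (s₀ + b), c' * (ENNReal.ofReal |u' t| * bandKernel δ (u t)) :=
          lintegral_const_mul_le _ _
      _ ≤ _ := setLIntegral_mono' measurableSet_Ioo fun t ht =>
          mul_le_mul_left (le_of_lt (hbA ht)) _
  · obtain ⟨c', hc1, hc2⟩ := exists_between hc
    obtain ⟨b, hb, hbη, hbA⟩ := hnear _ (hw.eventually (gt_mem_nhds hc1))
    filter_upwards [key b hb hbη] with δ hδ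
    rw [hrestr b hbη δ hδ.1]
    refine lt_of_le_of_lt ?_ hc2
    calc _ ≤ ∫⁻ t in Ioo (s₀ - b) (s₀ + b), c' * (ENNReal.ofReal |u' t| * bandKernel δ (u t)) :=
          setLIntegral_mono' measurableSet_Ioo fun t ht => mul_le_mul_left (le_of_lt (hbA ht)) _
      _ = c' := by rw [lintegral_const_mul' _ _ (ne_top_of_lt hc2), hδ.2, mul_one]

/-- Around a nondegenerate zero `s₀` of `u`, the measures `|u'| bandKernel δ (u)` concentrate at
`s₀` with total mass one. The sign of `u'` is constant by Darboux's theorem. -/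
lemma tendsto_lintegral_bandKernel {u u' : ℝ → ℝ} {w : ℝ → ℝ≥0∞} {s₀ η : ℝ} (hη : 0 < η)
    (hu : ∀ t ∈ Ioo (s₀ - η) (s₀ + η), HasDerivAt u (u' t) t)
    (hu' : ∀ t ∈ Ioo (s₀ - η) (s₀ + η), u' t ≠ 0) (h0 : u s₀ = 0) (hw : ContinuousAt w s₀) :
    Tendsto (fun δ => ∫⁻ t in Ioo (s₀ - η) (s₀ + η),
      w t * (ENNReal.ofReal |u' t| * bandKernel δ (u t))) (𝓝[>] 0) (𝓝 (w s₀)) := by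
  rcases hasDerivWithinAt_forall_lt_or_forall_gt_of_forall_ne (convex_Ioo (s₀ - η) (s₀ + η))
    (fun t ht => (hu t ht).hasDerivWithinAt) hu' with h | h
  · have := tendsto_lintegral_bandKernel_of_pos (u := fun t => -u t) (u' := fun t => -u' t) hη
      (fun t ht => (hu t ht).neg) (fun t ht => neg_pos.2 (h t ht)) (by simp [h0]) hw
    simpa only [abs_neg, bandKernel_neg] using this
  · exact tendsto_lintegral_bandKernel_of_pos hη hu h h0 hw

/-- A family of functions supported in a compact set, concentrating at finitely many points and
eventually vanishing locally elsewhere, has integrals tending to the sum of the local masses. -/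
lemma tendsto_lintegral_of_concentrating {g : ℝ → ℝ → ℝ≥0∞} {l : Filter ℝ} {C : Set ℝ}
    (hC : IsCompact C) (hg : ∀ δ, ∀ t ∉ C, g δ t = 0) (F : Finset ℝ) (c : ℝ → ℝ≥0∞)
    (hF : ∀ s ∈ F, ∃ η > 0, ∀ a, 0 < a → a ≤ η →
      Tendsto (fun δ => ∫⁻ t in Ioo (s - a) (s + a), g δ t) l (𝓝 (c s)))
    (hne : ∀ s ∈ C, s ∉ F → ∃ N ∈ 𝓝 s, ∀ᶠ δ in l, ∀ t ∈ N, g δ t = 0) :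
    Tendsto (fun δ => ∫⁻ t, g δ t) l (𝓝 (∑ s ∈ F, c s)) := by
  obtain ⟨U, hU, hdisj⟩ := F.finite_toSet.t2_separation
  have hch : ∀ s ∈ F, ∃ a > 0, Ioo (s - a) (s + a) ⊆ U s ∧
      Tendsto (fun δ => ∫⁻ t in Ioo (s - a) (s + a), g δ t) l (𝓝 (c s)) := by
    intro s hs
    obtain ⟨η, hη, h⟩ := hF s hs
    obtain ⟨ε, hε, hball⟩ := Metric.isOpen_iff.1 (hU s).2 s (hU s).1
    rw [Real.ball_eq_Ioo] at hball
    refine ⟨min ε η, by positivity, ?_, h _ (by positivity) (min_le_right _ _)⟩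
    exact (Ioo_subset_Ioo (by linarith [min_le_left ε η]) (by linarith [min_le_left ε η])).trans
      hball
  choose! a ha hasub hlim using hch
  set O : Set ℝ := ⋃ s ∈ F, Ioo (s - a s) (s + a s) with hO
  have hOo : IsOpen O := isOpen_biUnion fun _ _ => isOpen_Ioo
  have hev : ∀ᶠ δ in l, ∀ t ∈ C \ O, g δ t = 0 := by
    refine (hC.diff hOo).induction_on (p := fun A => ∀ᶠ δ in l, ∀ t ∈ A, g δ t = 0)
      (by simp) (fun s t hst ht => ht.mono fun δ h x hx => h x (hst hx))
      (fun s t hs ht => (hs.and ht).mono fun δ h x hx => hx.elim (h.1 x) (h.2 x)) ?_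
    intro s hs
    have hsF : s ∉ F := fun hsF => hs.2 (mem_biUnion hsF ⟨by linarith [ha s hsF],
      by linarith [ha s hsF]⟩)
    obtain ⟨N, hN, h⟩ := hne s hs.1 hsF
    exact ⟨N, mem_nhdsWithin_of_mem_nhds hN, h⟩
  refine (tendsto_finsetSum F fun s hs => hlim s hs).congr' ?_
  filter_upwards [hev] with δ hδ
  have hd : Set.PairwiseDisjoint (↑F) fun s => Ioo (s - a s) (s + a s) := by
    intro s hs t ht hst
    exact (hdisj hs ht hst).mono (hasub s hs) (hasub t ht)
  rw [← lintegral_biUnion_finset hd (fun _ _ => measurableSet_Ioo)]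
  refine setLIntegral_eq_of_support_subset ?_
  intro t ht
  by_contra htO
  refine ht ?_
  by_cases htC : t ∈ C
  · exact hδ t ⟨htC, htO⟩
  · exact hg δ t htC

/-! ### Surface measure and Lipschitz parametrizations -/

section Lipschitz

variable {X Y : Type*} [EMetricSpace X] [MeasurableSpace X] [BorelSpace X]
  [EMetricSpace Y] [MeasurableSpace Y] [BorelSpace Y]

lemma LipschitzOnWith.euclideanHausdorffMeasure_image_le {K : NNReal} {f : X → Y} {s : Set X}
    (h : LipschitzOnWith K f s) (n : ℕ) :
    (μHE[n] : Measure Y) (f '' s) ≤ (K : ℝ≥0∞) ^ n * (μHE[n] : Measure X) s := by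
  rw [Measure.euclideanHausdorffMeasure_def, Measure.euclideanHausdorffMeasure_def,
    Measure.smul_apply, Measure.smul_apply, ENNReal.smul_def, ENNReal.smul_def, smul_eq_mul,
    smul_eq_mul, mul_left_comm]
  gcongr
  simpa using h.hausdorffMeasure_image_le (d := n) (by positivity)

/-- If `f` is a contraction on `A` with a `K`-Lipschitz inverse `ψ`, integrals over `A` and over the
image of `A` agree up to the factor `K ^ n`. -/
lemma lintegral_euclideanHausdorffMeasure_bilipschitz {f : X → Y} {ψ : Y → X} {A : Set X}
    {K : NNReal} (n : ℕ) (hfA : MeasurableSet (f '' A))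
    (hf : LipschitzOnWith 1 f A) (hψ : LipschitzOnWith K ψ (f '' A))
    (hinv : ∀ x ∈ A, ψ (f x) = x) {h : X → ℝ≥0∞} (hh : Measurable h) :
    ∫⁻ y in f '' A, h (ψ y) ∂μHE[n] ≤ ∫⁻ x in A, h x ∂μHE[n] ∧
    ∫⁻ x in A, h x ∂μHE[n] ≤ (K : ℝ≥0∞) ^ n * ∫⁻ y in f '' A, h (ψ y) ∂μHE[n] := by
  have hψm : AEMeasurable ψ ((μHE[n] : Measure Y).restrict (f '' A)) :=
    hψ.continuousOn.aemeasurable hfA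
  have hset : ∀ s, f '' (s ∩ A) = ψ ⁻¹' s ∩ f '' A := by
    intro s
    ext y
    constructor
    · rintro ⟨x, ⟨hxs, hxA⟩, rfl⟩
      exact ⟨by rwa [mem_preimage, hinv x hxA], mem_image_of_mem _ hxA⟩
    · rintro ⟨hys, x, hxA, rfl⟩
      rw [mem_preimage, hinv x hxA] at hys
      exact ⟨x, ⟨hys, hxA⟩, rfl⟩
  have hmap : ∀ s, MeasurableSet s →
      (((μHE[n] : Measure Y).restrict (f '' A)).map ψ) s = (μHE[n] : Measure Y) (f '' (s ∩ A)) := by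
    intro s hs
    rw [Measure.map_apply_of_aemeasurable hψm hs, Measure.restrict_apply' hfA, hset]
  have h1 : ((μHE[n] : Measure Y).restrict (f '' A)).map ψ ≤ (μHE[n] : Measure X).restrict A := by
    refine Measure.le_iff.2 fun s hs => ?_
    rw [hmap s hs, Measure.restrict_apply hs]
    simpa using (hf.mono (inter_subset_right : s ∩ A ⊆ A)).euclideanHausdorffMeasure_image_le n
  have h2 : (μHE[n] : Measure X).restrict A ≤
      ((K : ℝ≥0∞) ^ n) • ((μHE[n] : Measure Y).restrict (f '' A)).map ψ := by
    refine Measure.le_iff.2 fun s hs => ?_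
    rw [Measure.smul_apply, hmap s hs, Measure.restrict_apply hs, smul_eq_mul]
    have := (hψ.mono
      (image_mono (inter_subset_right : s ∩ A ⊆ A))).euclideanHausdorffMeasure_image_le n
    have himg : ψ '' (f '' (s ∩ A)) = s ∩ A := by
      rw [image_image]
      exact (image_congr fun x hx => hinv x hx.2).trans (image_id' _)
    rwa [himg] at this
  rw [← lintegral_map' hh.aemeasurable hψm, ← smul_eq_mul, ← lintegral_smul_measure]
  exact ⟨lintegral_mono' h1 le_rfl, lintegral_mono' h2 le_rfl⟩

end Lipschitz

section Lines

variable {E : Type*} [NormedAddCommGroup E] [InnerProductSpace ℝ E]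

lemma eq_proj_add_smul {e : E} (he : ‖e‖ = 1) (x : E) :
    x = ((ℝ ∙ e)ᗮ.orthogonalProjectionOnto x : E) + ⟪e, x⟫ • e := by
  have h1 := (ℝ ∙ e).starProjection_add_starProjection_orthogonal x
  rw [Submodule.starProjection_unit_singleton ℝ he] at h1
  rw [add_comm]
  exact h1.symm

lemma proj_add_smul (e : E) (y : (ℝ ∙ e)ᗮ) (t : ℝ) :
    (ℝ ∙ e)ᗮ.orthogonalProjectionOnto ((y : E) + t • e) = y := by
  rw [map_add, Submodule.orthogonalProjectionOnto_mem_subspace_eq_self, map_smul,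
    Submodule.orthogonalProjectionOnto_orthogonal_apply_eq_zero]
  · simp
  · exact Submodule.mem_span_singleton_self e

/-- If `g` makes a small angle with the unit vector `e`, vectors orthogonal to `g` are not much
longer than their projections to the orthogonal complement of `e`. -/
lemma norm_le_mul_norm_proj {e g v : E} {κ : ℝ} (he : ‖e‖ = 1) (hκ : 0 ≤ κ) (hpos : 0 < ⟪g, e⟫)
    (hg : ‖g‖ ≤ κ * ⟪g, e⟫) (hv : ⟪g, v⟫ = 0) :
    ‖v‖ ≤ κ * ‖(ℝ ∙ e)ᗮ.orthogonalProjectionOnto v‖ := by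
  set w : E := ((ℝ ∙ e)ᗮ.orthogonalProjectionOnto v : E) with hw
  have hwe : ⟪e, w⟫ = 0 := by
    have := ((ℝ ∙ e)ᗮ.orthogonalProjectionOnto v).2
    exact Submodule.mem_orthogonal_singleton_iff_inner_right.1 this
  have hvw : v = w + ⟪e, v⟫ • e := eq_proj_add_smul he v
  set t := ⟪e, v⟫ with ht
  set a := ⟪g, e⟫ with ha
  have hee : ⟪e, e⟫ = 1 := by rw [real_inner_self_eq_norm_sq, he]; norm_num
  have hwe' : ⟪w, e⟫ = 0 := by rw [real_inner_comm]; exact hwe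
  have hge : ⟪e, g⟫ = a := real_inner_comm _ _
  have hnv : ‖v‖ ^ 2 = ‖w‖ ^ 2 + t ^ 2 := by
    rw [hvw, ← real_inner_self_eq_norm_sq, ← real_inner_self_eq_norm_sq]
    simp only [inner_add_left, inner_add_right, real_inner_smul_left, real_inner_smul_right, hwe,
      hwe', hee]
    ring
  have hgw : ⟪g - a • e, w⟫ = -(t * a) := by
    rw [hvw, inner_add_right, real_inner_smul_right] at hv
    rw [inner_sub_left, real_inner_smul_left, hwe]
    linarith
  have hgn : ‖g - a • e‖ ^ 2 = ‖g‖ ^ 2 - a ^ 2 := by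
    rw [← real_inner_self_eq_norm_sq, ← real_inner_self_eq_norm_sq]
    simp only [inner_sub_left, inner_sub_right, real_inner_smul_left, real_inner_smul_right, hee,
      hge, ← ha]
    ring
  have hcs : (t * a) ^ 2 ≤ (‖g‖ ^ 2 - a ^ 2) * ‖w‖ ^ 2 := by
    have := abs_real_inner_le_norm (g - a • e) w
    rw [hgw, abs_neg] at this
    rw [← hgn, ← mul_pow, ← sq_abs]
    gcongr
  have hg2 : ‖g‖ ^ 2 ≤ κ ^ 2 * a ^ 2 := by rw [← mul_pow]; gcongr
  have hmain : ‖v‖ ^ 2 ≤ (κ * ‖w‖) ^ 2 := by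
    have h3 : a ^ 2 * ‖v‖ ^ 2 ≤ a ^ 2 * (κ * ‖w‖) ^ 2 := by
      have : ‖g‖ ^ 2 * ‖w‖ ^ 2 ≤ κ ^ 2 * a ^ 2 * ‖w‖ ^ 2 := by gcongr
      rw [hnv]; nlinarith
    exact le_of_mul_le_mul_left h3 (by positivity)
  exact (abs_le_of_sq_le_sq' hmain (by positivity)).2

/-- Integration over `E` as iterated integration over the lines parallel to a unit vector `e`. -/
lemma lintegral_eq_lintegral_lines [FiniteDimensional ℝ E] [MeasurableSpace E]
    [BorelSpace E] {e : E} (he : ‖e‖ = 1) {G : E → ℝ≥0∞} (hG : Measurable G) :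
    ∫⁻ x, G x = ∫⁻ y : (ℝ ∙ e)ᗮ, ∫⁻ t : ℝ, G ((y : E) + t • e) := by
  have h1 := ((ℝ ∙ e).measurePreserving_measurableEquivProd (0 : E)).symm
  rw [InnerProductSpace.euclideanHausdorffMeasure_eq_volume] at h1
  rw [← h1.lintegral_comp hG]
  change ∫⁻ q, _ ∂((volume : Measure (ℝ ∙ e)).prod (volume : Measure (ℝ ∙ e)ᗮ)) = _
  rw [lintegral_prod_symm
    (fun q => G (((ℝ ∙ e).measurableEquivProd (0 : E)).symm q))
    (hG.comp (MeasurableEquiv.measurable _)).aemeasurable]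
  refine lintegral_congr fun y => ?_
  have h2 := (LinearIsometryEquiv.toSpanUnitSingleton (𝕜 := ℝ) e he).measurePreserving
  rw [← h2.lintegral_comp (by fun_prop)]
  refine lintegral_congr fun t => ?_
  simp [add_comm]

variable [CompleteSpace E]

lemma ContDiff.continuous_gradient {ρ : E → ℝ} (hρ : ContDiff ℝ 1 ρ) :
    Continuous (gradient ρ) :=
  (InnerProductSpace.toDual ℝ E).symm.continuous.comp (hρ.continuous_fderiv one_ne_zero)

lemma ContDiff.hasGradientAt {ρ : E → ℝ} (hρ : ContDiff ℝ 1 ρ) (x : E) :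
    HasGradientAt ρ (gradient ρ x) x :=
  ((hρ.differentiable one_ne_zero) x).hasGradientAt

lemma HasGradientAt.hasDerivAt_comp {ρ : E → ℝ} {g : E} {γ : ℝ → E} {γ' : E} {t : ℝ}
    (hρ : HasGradientAt ρ g (γ t)) (hγ : HasDerivAt γ γ' t) :
    HasDerivAt (fun s => ρ (γ s)) ⟪g, γ'⟫ t := by
  have := hρ.hasFDerivAt.comp_hasDerivAt t hγ
  rwa [InnerProductSpace.toDual_apply_apply] at this

lemma hasDerivAt_line {ρ : E → ℝ} (hρ : ContDiff ℝ 1 ρ) (e y : E) (t : ℝ) :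
    HasDerivAt (fun s : ℝ => ρ (y + s • e)) ⟪gradient ρ (y + t • e), e⟫ t := by
  refine (hρ.hasGradientAt _).hasDerivAt_comp ?_
  simpa using ((hasDerivAt_id t).smul_const e).const_add y

/-- On a ball where the gradient of `ρ` makes a small angle with `e`, the zero set of `ρ` is a
Lipschitz graph over the orthogonal complement of `e`. -/
lemma norm_sub_le_of_zeros {ρ : E → ℝ} (hρ : ContDiff ℝ 1 ρ) {e x₀ : E} {κ r₀ : ℝ} (he : ‖e‖ = 1)
    (hκ : 0 ≤ κ) (hB : ∀ x ∈ Metric.ball x₀ r₀, 0 < ⟪gradient ρ x, e⟫ ∧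
      ‖gradient ρ x‖ ≤ κ * ⟪gradient ρ x, e⟫) {x y : E} (hx : x ∈ Metric.ball x₀ r₀)
    (hy : y ∈ Metric.ball x₀ r₀) (hxy : ρ x = ρ y) :
    ‖x - y‖ ≤ κ * ‖(ℝ ∙ e)ᗮ.orthogonalProjectionOnto (x - y)‖ := by
  obtain ⟨z, hz, hz'⟩ := domain_mvt (f := ρ) (s := Metric.ball x₀ r₀)
    (f' := fun z => InnerProductSpace.toDual ℝ E (gradient ρ z))
    (fun z _ => (hρ.hasGradientAt z).hasFDerivAt.hasFDerivWithinAt) (convex_ball _ _) hy hx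
  have hzB : z ∈ Metric.ball x₀ r₀ := (convex_ball x₀ r₀).segment_subset hy hx hz
  refine norm_le_mul_norm_proj he hκ (hB z hzB).1 (hB z hzB).2 ?_
  rw [InnerProductSpace.toDual_apply_apply] at hz'
  rw [← hz', hxy, sub_self]

end Lines

/-! ### Surface integrals as limits of integrals over thin bands -/

lemma measurable_band_integrand {E : Type*} [NormedAddCommGroup E] [InnerProductSpace ℝ E]
    [MeasurableSpace E] [BorelSpace E] {ρ : E → ℝ} (hρ : ContDiff ℝ 1 ρ) {h k : E → ℝ}
    (hc : Continuous h) (hk : Continuous k) (δ : ℝ) :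
    Measurable fun x => ENNReal.ofReal (h x) * (ENNReal.ofReal (k x) * bandKernel δ (ρ x)) :=
  (ENNReal.measurable_ofReal.comp hc.measurable).mul
    ((ENNReal.measurable_ofReal.comp hk.measurable).mul
      ((measurable_bandKernel δ).comp hρ.continuous.measurable))

/-- On a ball where `∂ρ/∂e > 0`, the restriction of `ρ` to a line parallel to `e` is injective. -/
lemma injOn_line {E : Type*} [NormedAddCommGroup E] [InnerProductSpace ℝ E] [CompleteSpace E]
    {ρ : E → ℝ} (hρ : ContDiff ℝ 1 ρ) {e x₀ : E} {r₀ : ℝ}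
    (hB : ∀ x ∈ Metric.ball x₀ r₀, 0 < ⟪gradient ρ x, e⟫) (y : E) :
    InjOn (fun t : ℝ => ρ (y + t • e)) {t | y + t • e ∈ Metric.ball x₀ r₀} := by
  have hconv : Convex ℝ {t : ℝ | y + t • e ∈ Metric.ball x₀ r₀} := by
    intro a ha b hb p q hp hq hpq
    have := convex_ball x₀ r₀ ha hb hp hq hpq
    change y + (p * a + q * b) • e ∈ Metric.ball x₀ r₀
    convert this using 1
    rw [smul_add, smul_add, add_add_add_comm, ← add_smul, hpq, one_smul, add_smul, mul_smul,
      mul_smul]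
  refine StrictMonoOn.injOn (strictMonoOn_of_deriv_pos hconv ?_ fun t ht => ?_)
  · exact (hρ.continuous.comp (by fun_prop)).continuousOn
  · rw [(hasDerivAt_line hρ e y t).deriv]
    exact hB _ (interior_subset (s := {t : ℝ | y + t • e ∈ Metric.ball x₀ r₀}) ht)

section Coarea

variable {E : Type*} [NormedAddCommGroup E] [InnerProductSpace ℝ E] [FiniteDimensional ℝ E]

/-- Along a line through a ball where `∂ρ/∂e > 0`, the band integrals of a function supported in the
ball converge to the value of the function at the zero of `ρ` on the line, if there is one. -/
lemma tendsto_line_integral {ρ : E → ℝ} (hρ : ContDiff ℝ 1 ρ) {e x₀ : E} {r₀ : ℝ}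
    (hB : ∀ x ∈ Metric.ball x₀ r₀, 0 < ⟪gradient ρ x, e⟫) (he : ‖e‖ = 1) {h : E → ℝ}
    (hc : Continuous h) (hcs : HasCompactSupport h) (hsupp : tsupport h ⊆ Metric.ball x₀ r₀)
    {ψ : (ℝ ∙ e)ᗮ → E}
    (hψ : ∀ x ∈ {x | ρ x = 0} ∩ Metric.ball x₀ r₀, ψ ((ℝ ∙ e)ᗮ.orthogonalProjectionOnto x) = x)
    (y : (ℝ ∙ e)ᗮ) :
    Tendsto (fun δ => ∫⁻ t : ℝ, ENNReal.ofReal (h ((y : E) + t • e)) *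
      (ENNReal.ofReal |⟪gradient ρ ((y : E) + t • e), e⟫| * bandKernel δ (ρ ((y : E) + t • e))))
      (𝓝[>] 0)
      (𝓝 (((ℝ ∙ e)ᗮ.orthogonalProjectionOnto '' ({x | ρ x = 0} ∩ Metric.ball x₀ r₀)).indicator
        (fun y => ENNReal.ofReal (h (ψ y))) y)) := by
  have hline : Isometry fun t : ℝ => (y : E) + t • e := by
    refine Isometry.of_dist_eq fun s t => ?_
    rw [dist_add_left, dist_eq_norm, ← sub_smul, norm_smul, he, mul_one, Real.dist_eq,
      Real.norm_eq_abs]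
  set γ : ℝ → E := fun t => (y : E) + t • e with hγ
  have hC : IsCompact (γ ⁻¹' tsupport h) :=
    hline.isClosedEmbedding.isCompact_preimage hcs
  have hCz : ∀ δ, ∀ t ∉ γ ⁻¹' tsupport h, ENNReal.ofReal (h (γ t)) *
      (ENNReal.ofReal |⟪gradient ρ (γ t), e⟫| * bandKernel δ (ρ (γ t))) = 0 := by
    intro δ t ht
    rw [image_eq_zero_of_notMem_tsupport ht]; simp
  have hγc : Continuous γ := hline.continuous
  -- where `ρ` does not vanish, the band is avoided
  have hoff : ∀ s, ρ (γ s) ≠ 0 → ∃ N ∈ 𝓝 s, ∀ᶠ δ in 𝓝[>] (0 : ℝ), ∀ t ∈ N,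
      ENNReal.ofReal (h (γ t)) *
      (ENNReal.ofReal |⟪gradient ρ (γ t), e⟫| * bandKernel δ (ρ (γ t))) = 0 := by
    intro s hs
    have hpos := abs_pos.2 hs
    refine ⟨{t | |ρ (γ s)| / 2 < |ρ (γ t)|}, ?_, ?_⟩
    · exact ((hρ.continuous.comp hγc).abs.continuousAt).eventually
        (lt_mem_nhds (by simpa using hs))
    · filter_upwards [Ioo_mem_nhdsGT (half_pos hpos)] with δ hδ t ht
      rw [bandKernel_of_le (hδ.2.le.trans (le_of_lt ht))]; simp
  by_cases hy : y ∈ (ℝ ∙ e)ᗮ.orthogonalProjectionOnto '' ({x | ρ x = 0} ∩ Metric.ball x₀ r₀)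
  · rw [indicator_of_mem hy]
    obtain ⟨x, hx, hxy⟩ := hy
    have hψy : ψ y = x := by rw [← hxy]; exact hψ x hx
    rw [hψy]
    have hxt : γ ⟪e, x⟫ = x := by
      rw [hγ, ← hxy]
      exact (eq_proj_add_smul he x).symm
    set t₀ := ⟪e, x⟫ with ht₀
    have hnb : γ ⁻¹' Metric.ball x₀ r₀ ∈ 𝓝 t₀ :=
      hγc.continuousAt.preimage_mem_nhds (by rw [hxt]; exact Metric.isOpen_ball.mem_nhds hx.2)
    obtain ⟨η, hη, hηB⟩ := Metric.mem_nhds_iff.1 hnb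
    rw [Real.ball_eq_Ioo] at hηB
    have := tendsto_lintegral_of_concentrating (l := 𝓝[>] (0 : ℝ)) hC hCz {t₀}
      (fun t => ENNReal.ofReal (h (γ t))) ?_ ?_
    · simpa only [Finset.sum_singleton, hxt] using this
    · intro s hs
      rw [Finset.mem_singleton] at hs
      subst hs
      refine ⟨η, hη, fun a ha haη => ?_⟩
      have hsub : Ioo (t₀ - a) (t₀ + a) ⊆ Ioo (t₀ - η) (t₀ + η) :=
        Ioo_subset_Ioo (by linarith) (by linarith)
      refine tendsto_lintegral_bandKernel (u := fun t => ρ (γ t)) ha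
        (fun t _ => hasDerivAt_line hρ e y t) (fun t ht => (hB _ (hηB (hsub ht))).ne') ?_ ?_
      · rw [hxt]; exact hx.1
      · exact (ENNReal.continuous_ofReal.comp (hc.comp hγc)).continuousAt
    · intro s hs hst
      refine hoff s fun h0 => hst ?_
      rw [Finset.mem_singleton]
      refine injOn_line hρ hB y (hsupp hs) (show γ t₀ ∈ _ from hxt ▸ hx.2) ?_
      change ρ (γ s) = ρ (γ t₀)
      rw [h0, hxt]; exact hx.1.symm
  · rw [indicator_of_notMem hy]
    have := tendsto_lintegral_of_concentrating (l := 𝓝[>] (0 : ℝ)) hC hCz ∅ (fun _ => 0)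
      (by simp) ?_
    · simpa using this
    · intro s hs _
      refine hoff s fun h0 => hy ⟨γ s, ⟨h0, hsupp hs⟩, ?_⟩
      exact proj_add_smul e y s

variable [MeasurableSpace E] [BorelSpace E]

/-- Integrating over the lines parallel to `e`, the band integrals weighted with the derivative of
`ρ` in the direction `e` converge to an integral over the projection of the zero set of `ρ`. -/
lemma tendsto_band_integral_graph {ρ : E → ℝ} (hρ : ContDiff ℝ 1 ρ) {e x₀ : E} {r₀ : ℝ}
    (hB : ∀ x ∈ Metric.ball x₀ r₀, 0 < ⟪gradient ρ x, e⟫) (he : ‖e‖ = 1) {h : E → ℝ}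
    (hc : Continuous h) (hcs : HasCompactSupport h) (hsupp : tsupport h ⊆ Metric.ball x₀ r₀)
    {ψ : (ℝ ∙ e)ᗮ → E}
    (hψ : ∀ x ∈ {x | ρ x = 0} ∩ Metric.ball x₀ r₀, ψ ((ℝ ∙ e)ᗮ.orthogonalProjectionOnto x) = x)
    (hY : MeasurableSet
      ((ℝ ∙ e)ᗮ.orthogonalProjectionOnto '' ({x | ρ x = 0} ∩ Metric.ball x₀ r₀))) :
    Tendsto (fun δ => ∫⁻ x : E, ENNReal.ofReal (h x) *
      (ENNReal.ofReal |⟪gradient ρ x, e⟫| * bandKernel δ (ρ x))) (𝓝[>] 0)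
      (𝓝 (∫⁻ y in (ℝ ∙ e)ᗮ.orthogonalProjectionOnto '' ({x | ρ x = 0} ∩ Metric.ball x₀ r₀),
        ENNReal.ofReal (h (ψ y)))) ∧
    ∫⁻ y in (ℝ ∙ e)ᗮ.orthogonalProjectionOnto '' ({x | ρ x = 0} ∩ Metric.ball x₀ r₀),
        ENNReal.ofReal (h (ψ y)) ≠ ⊤ := by
  obtain ⟨Mb, hMb⟩ := hcs.exists_bound_of_continuous hc
  have hM : ∀ x, ENNReal.ofReal (h x) ≤ ENNReal.ofReal Mb := fun x =>
    ENNReal.ofReal_le_ofReal ((le_abs_self _).trans (hMb x))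
  set Kc : Set (ℝ ∙ e)ᗮ := (ℝ ∙ e)ᗮ.orthogonalProjectionOnto '' tsupport h with hKc
  have hKcc : IsCompact Kc := hcs.isCompact.image (ContinuousLinearMap.continuous _)
  have hfin : ∫⁻ y, Kc.indicator (fun _ => ENNReal.ofReal Mb) y ≠ ⊤ := by
    rw [lintegral_indicator hKcc.measurableSet, setLIntegral_const]
    exact ENNReal.mul_ne_top ENNReal.ofReal_ne_top hKcc.measure_lt_top.ne
  have hmeas : ∀ δ, Measurable fun x => ENNReal.ofReal (h x) *
      (ENNReal.ofReal |⟪gradient ρ x, e⟫| * bandKernel δ (ρ x)) := fun δ =>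
    measurable_band_integrand hρ hc ((hρ.continuous_gradient.inner continuous_const).abs) δ
  rw [← lintegral_indicator hY]
  refine ⟨?_, ?_⟩
  · simp_rw [fun δ => lintegral_eq_lintegral_lines he (hmeas δ)]
    refine tendsto_lintegral_filter_of_dominated_convergence _ ?_ ?_ hfin
      (ae_of_all _ fun y => tendsto_line_integral hρ hB he hc hcs hsupp hψ y)
    · refine Eventually.of_forall fun δ => ?_
      have : Measurable fun p : (ℝ ∙ e)ᗮ × ℝ => (p.1 : E) + p.2 • e := by fun_prop
      exact ((hmeas δ).comp this).lintegral_prod_right'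
    · filter_upwards [self_mem_nhdsWithin] with δ hδ
      refine ae_of_all _ fun y => ?_
      by_cases hy : y ∈ Kc
      · rw [indicator_of_mem hy]
        set I : Set ℝ := {t | (y : E) + t • e ∈ Metric.ball x₀ r₀} with hI
        have hIo : IsOpen I := Metric.isOpen_ball.preimage (by fun_prop)
        calc _ = ∫⁻ t in I, ENNReal.ofReal (h ((y : E) + t • e)) *
              (ENNReal.ofReal |⟪gradient ρ ((y : E) + t • e), e⟫| *
                bandKernel δ (ρ ((y : E) + t • e))) := by
              refine (setLIntegral_eq_of_support_subset fun t ht => ?_).symm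
              by_contra htI
              refine ht ?_
              change ENNReal.ofReal _ * _ = 0
              rw [image_eq_zero_of_notMem_tsupport fun hcon => htI (hsupp hcon)]; simp
          _ ≤ ∫⁻ t in I, ENNReal.ofReal Mb *
              (ENNReal.ofReal |⟪gradient ρ ((y : E) + t • e), e⟫| *
                bandKernel δ (ρ ((y : E) + t • e))) :=
              lintegral_mono fun t => mul_le_mul_left (hM _) _
          _ = ENNReal.ofReal Mb * ∫⁻ t in I,
              (ENNReal.ofReal |⟪gradient ρ ((y : E) + t • e), e⟫| *
                bandKernel δ (ρ ((y : E) + t • e))) :=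
              lintegral_const_mul' _ _ ENNReal.ofReal_ne_top
          _ ≤ ENNReal.ofReal Mb * 1 := by
              gcongr
              exact lintegral_abs_deriv_mul_bandKernel_le (u := fun t => ρ ((y : E) + t • e))
                hIo.measurableSet (fun t _ => (hasDerivAt_line hρ e y t).hasDerivWithinAt)
                (injOn_line hρ hB y) hδ
          _ = _ := mul_one _
      · rw [indicator_of_notMem hy, nonpos_iff_eq_zero]
        refine (lintegral_congr fun t => ?_).trans lintegral_zero
        rw [image_eq_zero_of_notMem_tsupport fun hcon => hy ⟨_, hcon, proj_add_smul e y t⟩]; simp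
  · refine ne_top_of_le_ne_top hfin (lintegral_mono fun y => ?_)
    by_cases hy : y ∈ Kc
    · rw [indicator_of_mem hy]
      exact (indicator_le_self' (fun _ _ => zero_le) _).trans (hM _)
    · rw [indicator_of_notMem hy]
      refine (indicator_apply_le' (fun hy' => ?_) fun _ => le_rfl)
      obtain ⟨x, hx, rfl⟩ := hy'
      rw [hψ x hx, image_eq_zero_of_notMem_tsupport fun hcon => hy ⟨x, hcon, rfl⟩]; simp

/-- `A δ` and `σ` agree, asymptotically as `δ → 0` and up to a factor `c`, with a finite limit `L`
of a common approximating family. This relation is additive in `(A, σ)`. -/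
def LimitUpToFactor (c : ℝ≥0∞) (A : ℝ → ℝ≥0∞) (σ : ℝ≥0∞) : Prop :=
  ∃ (B : ℝ → ℝ≥0∞) (L : ℝ≥0∞), L ≠ ⊤ ∧ Tendsto B (𝓝[>] 0) (𝓝 L) ∧
    (∀ᶠ δ in 𝓝[>] (0 : ℝ), B δ ≤ A δ ∧ A δ ≤ c * B δ) ∧ L ≤ σ ∧ σ ≤ c * L

lemma LimitUpToFactor.mono {c c' : ℝ≥0∞} {A : ℝ → ℝ≥0∞} {σ : ℝ≥0∞} (h : LimitUpToFactor c A σ)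
    (hc : c ≤ c') : LimitUpToFactor c' A σ := by
  obtain ⟨B, L, h1, h2, h3, h4, h5⟩ := h
  refine ⟨B, L, h1, h2, h3.mono fun δ h => ⟨h.1, h.2.trans ?_⟩, h4, h5.trans ?_⟩ <;> gcongr

lemma LimitUpToFactor.sum {ι : Type*} (s : Finset ι) {c : ℝ≥0∞} {A : ι → ℝ → ℝ≥0∞}
    {σ : ι → ℝ≥0∞} (h : ∀ i ∈ s, LimitUpToFactor c (A i) (σ i)) :
    LimitUpToFactor c (fun δ => ∑ i ∈ s, A i δ) (∑ i ∈ s, σ i) := by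
  choose! B L h1 h2 h3 h4 h5 using h
  refine ⟨fun δ => ∑ i ∈ s, B i δ, ∑ i ∈ s, L i, ?_, tendsto_finsetSum s h2, ?_,
    Finset.sum_le_sum h4, ?_⟩
  · exact ENNReal.sum_ne_top.2 h1
  · filter_upwards [(Filter.eventually_all_finset s).2 h3] with δ hδ
    refine ⟨Finset.sum_le_sum fun i hi => (hδ i hi).1, ?_⟩
    rw [Finset.mul_sum]
    exact Finset.sum_le_sum fun i hi => (hδ i hi).2
  · rw [Finset.mul_sum]
    exact Finset.sum_le_sum h5

lemma exists_one_lt_mul_lt {a b : ℝ≥0∞} (h : a < b) : ∃ c : ℝ≥0∞, 1 < c ∧ c ≠ ⊤ ∧ c * a < b := by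
  have hlim : Tendsto (fun c : ℝ≥0∞ => c * a) (𝓝[>] 1) (𝓝 a) := by
    have : Tendsto (fun c : ℝ≥0∞ => c * a) (𝓝 1) (𝓝 (1 * a)) :=
      ENNReal.Tendsto.mul_const tendsto_id (Or.inl one_ne_zero)
    rw [one_mul] at this
    exact this.mono_left nhdsWithin_le_nhds
  have hne : (𝓝[>] (1 : ℝ≥0∞)).NeBot := nhdsGT_neBot_of_exists_gt ⟨2, by norm_num⟩
  have e1 : ∀ᶠ c in 𝓝[>] (1 : ℝ≥0∞), 1 < c := self_mem_nhdsWithin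
  have e2 : ∀ᶠ c in 𝓝[>] (1 : ℝ≥0∞), c < ⊤ :=
    mem_nhdsWithin_of_mem_nhds (gt_mem_nhds (by simp))
  obtain ⟨c, h1, h2, h3⟩ := (e1.and (e2.and (hlim.eventually (gt_mem_nhds h)))).exists
  exact ⟨c, h1, h2.ne, h3⟩

lemma tendsto_of_limitUpToFactor {A : ℝ → ℝ≥0∞} {σ : ℝ≥0∞}
    (h : ∀ c : ℝ≥0∞, 1 < c → LimitUpToFactor c A σ) : Tendsto A (𝓝[>] 0) (𝓝 σ) ∧ σ ≠ ⊤ := by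
  have hσ : σ ≠ ⊤ := by
    obtain ⟨B, L, h1, -, -, -, h5⟩ := h 2 (by norm_num)
    exact ne_top_of_le_ne_top (ENNReal.mul_ne_top (by simp) h1) h5
  refine ⟨tendsto_order.2 ⟨fun a ha => ?_, fun a ha => ?_⟩, hσ⟩
  · obtain ⟨c, hc1, -, hc2⟩ := exists_one_lt_mul_lt ha
    obtain ⟨B, L, -, h2, h3, -, h5⟩ := h c hc1
    have haL : a < L := by
      by_contra hcon
      rw [not_lt] at hcon
      have : c * L ≤ c * a := by gcongr
      exact absurd (hc2.trans_le h5) (not_lt.2 this)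
    filter_upwards [h2.eventually (lt_mem_nhds haL), h3] with δ hδ hδ'
    exact hδ.trans_le hδ'.1
  · obtain ⟨c, hc1, hc3, hc2⟩ := exists_one_lt_mul_lt ha
    obtain ⟨B, L, -, h2, h3, h4, -⟩ := h c hc1
    have h6 : Tendsto (fun δ => c * B δ) (𝓝[>] 0) (𝓝 (c * L)) :=
      ENNReal.Tendsto.const_mul h2 (Or.inr hc3)
    have haL : c * L < a := lt_of_le_of_lt (by gcongr) hc2
    filter_upwards [h6.eventually (gt_mem_nhds haL), h3] with δ hδ hδ'
    exact hδ'.2.trans_lt hδ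

/-- Near a zero `x₀` of `ρ` with `∇ρ(x₀) ≠ 0`, band integrals and surface integrals agree up to a
factor close to one: with `e = ∇ρ(x₀)/‖∇ρ(x₀)‖`, the functions `‖∇ρ‖` and `∂ρ/∂e` almost agree near
`x₀`, and the projection along `e` almost preserves distances on the surface. -/
lemma exists_ball_limitUpToFactor {n : ℕ} (hn : Module.finrank ℝ E = n + 1) {ρ : E → ℝ}
    (hρ : ContDiff ℝ 1 ρ) {x₀ : E} (hx₀ : gradient ρ x₀ ≠ 0) {c : ℝ≥0∞} (hc1 : 1 < c) :
    ∃ r₀ > 0, ∀ h : E → ℝ, Continuous h → HasCompactSupport h → tsupport h ⊆ Metric.ball x₀ r₀ →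
      LimitUpToFactor c
        (fun δ => ∫⁻ x, ENNReal.ofReal (h x) *
          (ENNReal.ofReal ‖gradient ρ x‖ * bandKernel δ (ρ x)))
        (∫⁻ x in {x | ρ x = 0}, ENNReal.ofReal (h x) ∂μHE[n]) := by
  -- a factor `κ > 1` with `κ ≤ c` and `κ ^ n ≤ c`
  obtain ⟨κ, hκ1, hκc⟩ : ∃ κ : NNReal, 1 < κ ∧ (κ : ℝ≥0∞) ^ (n + 1) ≤ c := by
    have hlim : Tendsto (fun κ : NNReal => (κ : ℝ≥0∞) ^ (n + 1)) (𝓝[>] 1) (𝓝 1) := by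
      have : Continuous fun κ : NNReal => (κ : ℝ≥0∞) ^ (n + 1) :=
        (ENNReal.continuous_pow _).comp ENNReal.continuous_coe
      have h := this.tendsto 1
      simp only [ENNReal.coe_one, one_pow] at h
      exact h.mono_left nhdsWithin_le_nhds
    have hne : (𝓝[>] (1 : NNReal)).NeBot := nhdsGT_neBot_of_exists_gt ⟨2, by norm_num⟩
    have e1 : ∀ᶠ κ in 𝓝[>] (1 : NNReal), 1 < κ := self_mem_nhdsWithin
    obtain ⟨κ, h1, h2⟩ := (e1.and (hlim.eventually (gt_mem_nhds hc1))).exists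
    exact ⟨κ, h1, h2.le⟩
  have hκ1' : (1 : ℝ≥0∞) ≤ κ := by exact_mod_cast hκ1.le
  have hκc1 : (κ : ℝ≥0∞) ≤ c :=
    le_trans (le_self_pow₀ hκ1' (Nat.succ_ne_zero n)) hκc
  have hκcn : (κ : ℝ≥0∞) ^ n ≤ c := le_trans (pow_le_pow_right₀ hκ1' (Nat.le_succ n)) hκc
  have hκR : (1 : ℝ) < κ := by exact_mod_cast hκ1
  set e : E := ‖gradient ρ x₀‖⁻¹ • gradient ρ x₀ with he_def
  have he : ‖e‖ = 1 := by
    rw [he_def, norm_smul, norm_inv, norm_norm, inv_mul_cancel₀ (norm_ne_zero_iff.2 hx₀)]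
  have hee : ⟪gradient ρ x₀, e⟫ = ‖gradient ρ x₀‖ := by
    rw [he_def, real_inner_smul_right, real_inner_self_eq_norm_sq]
    field_simp [norm_ne_zero_iff.2 hx₀]
  have hgpos : 0 < ‖gradient ρ x₀‖ := norm_pos_iff.2 hx₀
  have hgc := hρ.continuous_gradient
  obtain ⟨r₀, hr₀, hball⟩ : ∃ r₀ > 0, ∀ x ∈ Metric.ball x₀ r₀, 0 < ⟪gradient ρ x, e⟫ ∧
      ‖gradient ρ x‖ ≤ κ * ⟪gradient ρ x, e⟫ := by
    have h1 : ∀ᶠ x in 𝓝 x₀, 0 < ⟪gradient ρ x, e⟫ :=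
      ((hgc.inner continuous_const).tendsto x₀).eventually
        (lt_mem_nhds (by rw [hee]; exact hgpos))
    have h2 : ∀ᶠ x in 𝓝 x₀, 0 < κ * ⟪gradient ρ x, e⟫ - ‖gradient ρ x‖ := by
      have : Continuous fun x => κ * ⟪gradient ρ x, e⟫ - ‖gradient ρ x‖ :=
        (continuous_const.mul (hgc.inner continuous_const)).sub hgc.norm
      refine (this.tendsto x₀).eventually (lt_mem_nhds ?_)
      rw [hee]; nlinarith
    obtain ⟨r₀, hr₀, h⟩ := Metric.mem_nhds_iff.1 (h1.and h2)
    exact ⟨r₀, hr₀, fun x hx => ⟨(h hx).1, by linarith [(h hx).2]⟩⟩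
  refine ⟨r₀, hr₀, fun h hc hcs hsupp => ?_⟩
  set A : Set E := {x | ρ x = 0} ∩ Metric.ball x₀ r₀ with hA
  have hSm : MeasurableSet {x | ρ x = 0} :=
    (isClosed_eq hρ.continuous continuous_const).measurableSet
  have hAm : MeasurableSet A := hSm.inter measurableSet_ball
  set π := (ℝ ∙ e)ᗮ.orthogonalProjectionOnto with hπ
  have hanti : ∀ x ∈ A, ∀ y ∈ A, dist x y ≤ κ * dist (π x) (π y) := by
    intro x hx y hy
    rw [dist_eq_norm, dist_eq_norm, ← map_sub]
    exact norm_sub_le_of_zeros hρ he κ.coe_nonneg hball hx.2 hy.2 (hx.1.trans hy.1.symm)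
  have hinj : InjOn π A := by
    intro x hx y hy hxy
    have := hanti x hx y hy
    rw [hxy, dist_self, mul_zero] at this
    exact dist_le_zero.1 this
  set ψ : (ℝ ∙ e)ᗮ → E := Function.invFunOn π A with hψ
  have hinv : ∀ x ∈ A, ψ (π x) = x := hinj.leftInvOn_invFunOn
  have hY : MeasurableSet (π '' A) := hAm.image_of_continuousOn_injOn π.continuous.continuousOn hinj
  have hψL : LipschitzOnWith κ ψ (π '' A) := by
    refine LipschitzOnWith.of_dist_le_mul ?_
    rintro _ ⟨x, hx, rfl⟩ _ ⟨y, hy, rfl⟩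
    rw [hinv x hx, hinv y hy]
    exact hanti x hx y hy
  have hfr : Module.finrank ℝ (ℝ ∙ e)ᗮ = n := by
    have := (ℝ ∙ e).finrank_add_finrank_orthogonal
    rw [finrank_span_singleton (norm_ne_zero_iff.1 (by rw [he]; exact one_ne_zero)), hn] at this
    omega
  have hvol : (μHE[n] : Measure (ℝ ∙ e)ᗮ) = volume := by
    rw [← hfr]; exact InnerProductSpace.euclideanHausdorffMeasure_eq_volume
  obtain ⟨hlim, hfin⟩ := tendsto_band_integral_graph hρ (fun x hx => (hball x hx).1) he hc hcs hsupp
    hinv hY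
  have hbil := lintegral_euclideanHausdorffMeasure_bilipschitz n hY
    ((ℝ ∙ e)ᗮ.lipschitzWith_orthogonalProjectionOnto.lipschitzOnWith) hψL hinv
    (ENNReal.measurable_ofReal.comp hc.measurable)
  rw [hvol] at hbil
  have hσ : ∫⁻ x in {x | ρ x = 0}, ENNReal.ofReal (h x) ∂μHE[n] =
      ∫⁻ x in A, ENNReal.ofReal (h x) ∂μHE[n] := by
    rw [← lintegral_indicator hSm, ← lintegral_indicator hAm]
    refine lintegral_congr fun x => ?_
    by_cases hx : x ∈ Metric.ball x₀ r₀
    · simp [indicator, hA, hx]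
    · have h0 : h x = 0 := image_eq_zero_of_notMem_tsupport fun hcon => hx (hsupp hcon)
      simp [indicator, h0]
  refine ⟨_, _, hfin, hlim, Eventually.of_forall fun δ => ⟨?_, ?_⟩, ?_, ?_⟩
  · refine lintegral_mono fun x => ?_
    gcongr
    exact (abs_real_inner_le_norm _ _).trans (by rw [he, mul_one])
  · refine le_trans ?_ (mul_le_mul_left hκc1 _)
    rw [← lintegral_const_mul' _ _ ENNReal.coe_ne_top]
    refine lintegral_mono fun x => ?_
    by_cases hx : x ∈ Metric.ball x₀ r₀
    · have hle : ENNReal.ofReal ‖gradient ρ x‖ ≤ κ * ENNReal.ofReal |⟪gradient ρ x, e⟫| := by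
        rw [← ENNReal.ofReal_coe_nnreal, ← ENNReal.ofReal_mul κ.coe_nonneg]
        exact ENNReal.ofReal_le_ofReal ((hball x hx).2.trans (by gcongr; exact le_abs_self _))
      calc _ ≤ ENNReal.ofReal (h x) *
            (κ * ENNReal.ofReal |⟪gradient ρ x, e⟫| * bandKernel δ (ρ x)) := by gcongr
        _ = _ := by ring
    · have h0 : h x = 0 := image_eq_zero_of_notMem_tsupport fun hcon => hx (hsupp hcon)
      simp [h0]
  · rw [hσ]; exact hbil.1
  · rw [hσ]; exact hbil.2.trans (mul_le_mul_left hκcn _)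

/-- **Coarea limit.** If `ρ` is `C¹` with nonvanishing gradient on the part of its zero set inside
the support of `h`, the integral of `h` over the zero set is the limit of normalized integrals of
`h ‖∇ρ‖` over the bands `|ρ| < δ`. -/
theorem tendsto_band_integral {n : ℕ} (hn : Module.finrank ℝ E = n + 1) {ρ : E → ℝ}
    (hρ : ContDiff ℝ 1 ρ) {h : E → ℝ} (hc : Continuous h) (hcs : HasCompactSupport h)
    (h0 : ∀ x ∈ tsupport h, ρ x = 0 → gradient ρ x ≠ 0) :
    Tendsto (fun δ => ∫⁻ x, ENNReal.ofReal (h x) *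
      (ENNReal.ofReal ‖gradient ρ x‖ * bandKernel δ (ρ x))) (𝓝[>] 0)
      (𝓝 (∫⁻ x in {x | ρ x = 0}, ENNReal.ofReal (h x) ∂μHE[n])) ∧
    ∫⁻ x in {x | ρ x = 0}, ENNReal.ofReal (h x) ∂μHE[n] ≠ ⊤ := by
  refine tendsto_of_limitUpToFactor fun c hc1 => ?_
  have hloc : ∀ x ∈ tsupport h, ∃ r₀ > 0, ∀ h : E → ℝ, Continuous h → HasCompactSupport h →
      tsupport h ⊆ Metric.ball x r₀ → LimitUpToFactor c
        (fun δ => ∫⁻ x, ENNReal.ofReal (h x) *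
          (ENNReal.ofReal ‖gradient ρ x‖ * bandKernel δ (ρ x)))
        (∫⁻ x in {x | ρ x = 0}, ENNReal.ofReal (h x) ∂μHE[n]) := by
    intro x hx
    by_cases hρx : ρ x = 0
    · exact exists_ball_limitUpToFactor hn hρ (h0 x hx hρx) hc1
    -- away from the zero set both sides vanish
    · have hpos := abs_pos.2 hρx
      obtain ⟨r₀, hr₀, hball⟩ := Metric.mem_nhds_iff.1
        ((hρ.continuous.abs.tendsto x).eventually (lt_mem_nhds (half_lt_self hpos)))
      refine ⟨r₀, hr₀, fun h hc hcs hsupp => ⟨fun _ => 0, 0, ENNReal.zero_ne_top,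
        tendsto_const_nhds, ?_, zero_le, ?_⟩⟩
      · filter_upwards [Ioo_mem_nhdsGT (half_pos hpos)] with δ hδ
        refine ⟨zero_le, ?_⟩
        rw [mul_zero, nonpos_iff_eq_zero]
        refine (lintegral_congr fun z => ?_).trans lintegral_zero
        by_cases hz : z ∈ tsupport h
        · rw [bandKernel_of_le (hδ.2.le.trans (le_of_lt (hball (hsupp hz))))]; simp
        · rw [image_eq_zero_of_notMem_tsupport hz]; simp
      · rw [mul_zero, nonpos_iff_eq_zero]
        refine (setLIntegral_congr_fun (g := fun _ => 0)
          (isClosed_eq hρ.continuous continuous_const).measurableSet fun z hz => ?_).trans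
          lintegral_zero
        have hz0 : ρ z = 0 := hz
        have hzs : z ∉ tsupport h := fun hcon => by
          have : |ρ x| / 2 < |ρ z| := hball (hsupp hcon)
          rw [hz0, abs_zero] at this
          linarith
        simp [image_eq_zero_of_notMem_tsupport hzs]
  choose! r₀ hr₀ hr using hloc
  obtain ⟨t, ht, htcov⟩ := hcs.isCompact.elim_nhds_subcover (fun x => Metric.ball x (r₀ x))
    fun x hx => Metric.ball_mem_nhds x (hr₀ x hx)
  let v : Fin t.card → E := fun i => (t.equivFin.symm i : E)
  have hv : ∀ i, v i ∈ tsupport h := fun i => ht _ (t.equivFin.symm i).2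
  obtain ⟨χ, hχ1, hχ2, hχ3, hχ4⟩ := exists_continuous_sum_one_of_isOpen_isCompact
    (s := fun i => Metric.ball (v i) (r₀ (v i))) (fun i => Metric.isOpen_ball) hcs.isCompact
    (htcov.trans (iUnion₂_subset fun x hx => by
      have := subset_iUnion (fun i => Metric.ball (v i) (r₀ (v i))) (t.equivFin ⟨x, hx⟩)
      simpa [v] using this))
  have hsum : ∀ x, ENNReal.ofReal (h x) = ∑ i, ENNReal.ofReal (χ i x * h x) := by
    intro x
    by_cases hx : x ∈ tsupport h
    · have h1 : ∑ i, χ i x = 1 := by simpa using hχ2 hx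
      simp_rw [fun i => ENNReal.ofReal_mul (p := χ i x) (q := h x) (hχ3 i x).1]
      rw [← Finset.sum_mul, ← ENNReal.ofReal_sum_of_nonneg fun i _ => (hχ3 i x).1, h1]
      simp
    · simp [image_eq_zero_of_notMem_tsupport hx]
  have hfam := LimitUpToFactor.sum Finset.univ fun i _ =>
    hr (v i) (hv i) (fun x => χ i x * h x) ((χ i).continuous.mul hc) hcs.mul_left
      ((tsupport_mul_subset_left (f := χ i) (g := h)).trans (hχ1 i))
  have hχh : ∀ i, Continuous fun x => χ i x * h x := fun i => (χ i).continuous.mul hc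
  convert hfam using 1
  · funext δ
    rw [← lintegral_finsetSum _ fun i _ => measurable_band_integrand hρ
      (hχh i) hρ.continuous_gradient.norm δ]
    refine lintegral_congr fun x => ?_
    rw [hsum x, Finset.sum_mul]
  · rw [← lintegral_finsetSum _ fun i _ => (hχh i).measurable.ennreal_ofReal]
    exact lintegral_congr fun x => hsum x

end Coarea

/-! ### Counting crossings along piecewise smooth paths -/

section Paths

variable {d : ℕ} {𝒳 : Set (EuclideanSpace ℝ (Fin d))}
  {r : EuclideanSpace ℝ (Fin d) → EuclideanSpace ℝ (Fin d)}
  {φ : EuclideanSpace ℝ (Fin d) → ℝ → EuclideanSpace ℝ (Fin d)}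
  {ρ χ : EuclideanSpace ℝ (Fin d) → ℝ} {Z : ℝ → EuclideanSpace ℝ (Fin d)}
  {S : Set (EuclideanSpace ℝ (Fin d))}

/-- The path `Z` on `[0, ∞)` is a trajectory of the flow `φ` on a one-sided neighbourhood of every
time, on the right including the time itself. -/
structure FollowsFlow (𝒳 : Set (EuclideanSpace ℝ (Fin d)))
    (φ : EuclideanSpace ℝ (Fin d) → ℝ → EuclideanSpace ℝ (Fin d))
    (Z : ℝ → EuclideanSpace ℝ (Fin d)) : Prop where
  right : ∀ t, 0 ≤ t → ∃ ζ ∈ 𝒳, ∃ τ, ∀ᶠ s in 𝓝[≥] t, Z s = φ ζ (s - τ)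
  left : ∀ t, 0 < t → ∃ ζ ∈ 𝒳, ∃ τ, ∀ᶠ s in 𝓝[<] t, Z s = φ ζ (s - τ)

lemma IsFlowOf.hasDerivAt_shift (hφ : IsFlowOf 𝒳 r φ) {ζ : EuclideanSpace ℝ (Fin d)} (hζ : ζ ∈ 𝒳)
    (τ t : ℝ) : HasDerivAt (fun s => φ ζ (s - τ)) (r (φ ζ (t - τ))) t :=
  (hφ.hasDerivAt ζ hζ (t - τ)).comp_sub_const t τ

lemma IsFlowOf.continuous (hφ : IsFlowOf 𝒳 r φ) {ζ : EuclideanSpace ℝ (Fin d)} (hζ : ζ ∈ 𝒳) :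
    Continuous (φ ζ) :=
  continuous_iff_continuousAt.2 fun t => (hφ.hasDerivAt ζ hζ t).continuousAt

namespace FollowsFlow

lemma mem (hφ : IsFlowOf 𝒳 r φ) (hZ : FollowsFlow 𝒳 φ Z) {t : ℝ} (ht : 0 ≤ t) : Z t ∈ 𝒳 := by
  obtain ⟨ζ, hζ, τ, h⟩ := hZ.right t ht
  rw [h.self_of_nhdsWithin self_mem_Ici]
  exact hφ.mem ζ hζ _

lemma hasDerivWithinAt_Ici (hφ : IsFlowOf 𝒳 r φ) (hZ : FollowsFlow 𝒳 φ Z) {t : ℝ} (ht : 0 ≤ t) :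
    HasDerivWithinAt Z (r (Z t)) (Ici t) t := by
  obtain ⟨ζ, hζ, τ, h⟩ := hZ.right t ht
  have h0 := h.self_of_nhdsWithin self_mem_Ici
  rw [h0]
  exact (hφ.hasDerivAt_shift hζ τ t).hasDerivWithinAt.congr_of_eventuallyEq h h0

/-- Left limits exist, and where the left limit is the value the path is differentiable, as its left
and right derivatives are both given by the vector field. -/
lemma exists_left_limit (hφ : IsFlowOf 𝒳 r φ) (hZ : FollowsFlow 𝒳 φ Z) {t : ℝ} (ht : 0 < t) :
    ∃ z ∈ 𝒳, Tendsto Z (𝓝[<] t) (𝓝 z) ∧ (z = Z t → HasDerivAt Z (r (Z t)) t) := by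
  obtain ⟨ζ, hζ, τ, h⟩ := hZ.left t ht
  have hd := hφ.hasDerivAt_shift hζ τ t
  refine ⟨φ ζ (t - τ), hφ.mem ζ hζ _, ?_, fun hz => ?_⟩
  · exact (hd.continuousAt.continuousWithinAt.tendsto).congr' (h.mono fun s hs => hs.symm)
  · have h1 : HasDerivWithinAt Z (r (Z t)) (Iio t) t := by
      rw [← hz]
      exact hd.hasDerivWithinAt.congr_of_eventuallyEq h hz.symm
    have h2 := h1.union (hZ.hasDerivWithinAt_Ici hφ ht.le)
    rwa [Iio_union_Ici, hasDerivWithinAt_univ] at h2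

lemma eventually_hasDerivAt (hφ : IsFlowOf 𝒳 r φ) (hZ : FollowsFlow 𝒳 φ Z) {t : ℝ} (ht : 0 < t) :
    ∀ᶠ s in 𝓝[≠] t, HasDerivAt Z (r (Z s)) s := by
  have key : ∀ I : Set ℝ, IsOpen I → (∃ ζ ∈ 𝒳, ∃ τ, ∀ᶠ s in 𝓝[I] t, Z s = φ ζ (s - τ)) →
      ∀ᶠ s in 𝓝[I] t, HasDerivAt Z (r (Z s)) s := by
    rintro I hI ⟨ζ, hζ, τ, h⟩
    filter_upwards [eventually_eventually_nhdsWithin.2 h, self_mem_nhdsWithin] with s hs hsI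
    rw [hI.nhdsWithin_eq hsI] at hs
    rw [hs.self_of_nhds]
    exact (hφ.hasDerivAt_shift hζ τ s).congr_of_eventuallyEq hs
  rw [← Iio_union_Ioi, nhdsWithin_union, eventually_sup]
  refine ⟨key _ isOpen_Iio (hZ.left t ht), key _ isOpen_Ioi ?_⟩
  obtain ⟨ζ, hζ, τ, h⟩ := hZ.right t ht.le
  exact ⟨ζ, hζ, τ, h.filter_mono (nhdsWithin_mono _ Ioi_subset_Ici_self)⟩

end FollowsFlow

/-- Near a time at which a path passes continuously through the zero set of `ρ`, where the flow is
transversal, `ρ` along the path is differentiable with nonzero derivative. -/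
lemma exists_hasDerivAt_crossing (h𝒳 : IsOpen 𝒳) (hr : ContinuousOn r 𝒳) (hφ : IsFlowOf 𝒳 r φ)
    (hρ : ContDiff ℝ 1 ρ) (hZ : FollowsFlow 𝒳 φ Z) {s : ℝ} (hs : 0 < s)
    (hleft : Tendsto Z (𝓝[<] s) (𝓝 (Z s))) (hF : ⟪gradient ρ (Z s), r (Z s)⟫ ≠ 0) :
    ContinuousAt Z s ∧ ∃ η > 0, ∀ t ∈ Ioo (s - η) (s + η),
      HasDerivAt (fun t => ρ (Z t)) ⟪gradient ρ (Z t), r (Z t)⟫ t ∧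
      ⟪gradient ρ (Z t), r (Z t)⟫ ≠ 0 := by
  obtain ⟨z, -, hz, hd⟩ := hZ.exists_left_limit hφ hs
  have hds : HasDerivAt Z (r (Z s)) s := hd (tendsto_nhds_unique hz hleft)
  refine ⟨hds.continuousAt, ?_⟩
  have hFc : ContinuousAt (fun x => ⟪gradient ρ x, r x⟫) (Z s) :=
    hρ.continuous_gradient.continuousAt.inner
      (hr.continuousAt (h𝒳.mem_nhds (hZ.mem hφ hs.le)))
  have h1 : ∀ᶠ t in 𝓝 s, HasDerivAt Z (r (Z t)) t := by
    have := hZ.eventually_hasDerivAt hφ hs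
    rw [eventually_nhdsWithin_iff] at this
    filter_upwards [this] with t ht
    by_cases hts : t = s
    · rw [hts]; exact hds
    · exact ht hts
  have h2 : ∀ᶠ t in 𝓝 s, ⟪gradient ρ (Z t), r (Z t)⟫ ≠ 0 :=
    (hFc.comp hds.continuousAt).eventually_ne hF
  obtain ⟨η, hη, h⟩ := Metric.mem_nhds_iff.1 (h1.and h2)
  rw [Real.ball_eq_Ioo] at h
  exact ⟨η, hη, fun t ht => ⟨(hρ.hasGradientAt _).hasDerivAt_comp (h ht).1, (h ht).2⟩⟩

lemma ne_zero_of_hasDerivAt_ne_zero {u u' : ℝ → ℝ} {s η : ℝ} (hη : 0 < η)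
    (hu : ∀ t ∈ Ioo (s - η) (s + η), HasDerivAt u (u' t) t ∧ u' t ≠ 0) (h0 : u s = 0) {t : ℝ}
    (ht : t ∈ Ioo (s - η) (s + η)) (hts : t ≠ s) : u t ≠ 0 := by
  intro hut
  have hs : s ∈ Ioo (s - η) (s + η) := ⟨by linarith, by linarith⟩
  have main : ∀ a ∈ Ioo (s - η) (s + η), ∀ b ∈ Ioo (s - η) (s + η), a < b → u a = u b → False := by
    intro a ha b hb hab huab
    have hsub : Icc a b ⊆ Ioo (s - η) (s + η) := Icc_subset_Ioo ha.1 hb.2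
    obtain ⟨c, hc, hc'⟩ := exists_hasDerivAt_eq_zero hab
      (fun x hx => (hu x (hsub hx)).1.continuousAt.continuousWithinAt) huab
      (fun x hx => (hu x (hsub (Ioo_subset_Icc_self hx))).1)
    exact (hu c (hsub (Ioo_subset_Icc_self hc))).2 hc'
  rcases lt_or_gt_of_ne hts with h | h
  · exact main t ht s hs h (hut.trans h0.symm)
  · exact main s hs t ht h (h0.trans hut.symm)

/-- **Kac–Rice along a path.** For a piecewise smooth path which does not jump from or to `S` and is
outside `S` at the times `0` and `H`, the smoothed crossing numbers converge to the number of
continuous crossings. -/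
theorem tendsto_crossingCount (h𝒳 : IsOpen 𝒳) (hr : ContinuousOn r 𝒳) (hφ : IsFlowOf 𝒳 r φ)
    (hρ : ContDiff ℝ 1 ρ) (hS : S = {x ∈ 𝒳 | ρ x = 0})
    (hF : ∀ x ∈ S, ⟪gradient ρ x, r x⟫ ≠ 0) (hχ : Continuous χ) (hχ1 : ∀ x ∈ S, χ x = 1)
    (hZ : FollowsFlow 𝒳 φ Z) (hnj : NoJumpFromOrTo Z S) {H : ℝ} (h0 : Z 0 ∉ S) (hH : Z H ∉ S) :
    Tendsto (fun δ => ∫⁻ t in Icc 0 H, ENNReal.ofReal (χ (Z t)) *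
      (ENNReal.ofReal |⟪gradient ρ (Z t), r (Z t)⟫| * bandKernel δ (ρ (Z t)))) (𝓝[>] 0)
      (𝓝 (crossingCount Z S H : ℝ≥0∞)) := by
  -- at times in `S` the path crosses continuously and transversally
  have hcross : ∀ s ∈ Icc 0 H, Z s ∈ S → s ∈ Ioo 0 H ∧ Tendsto Z (𝓝[<] s) (𝓝 (Z s)) ∧
      ContinuousAt Z s ∧ ρ (Z s) = 0 ∧ ∃ η > 0, ∀ t ∈ Ioo (s - η) (s + η),
      HasDerivAt (fun t => ρ (Z t)) ⟪gradient ρ (Z t), r (Z t)⟫ t ∧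
      ⟪gradient ρ (Z t), r (Z t)⟫ ≠ 0 := by
    intro s hs hsS
    have hs0 : 0 < s := lt_of_le_of_ne hs.1 fun h => h0 (h ▸ hsS)
    have hsH : s < H := lt_of_le_of_ne hs.2 fun h => hH (h ▸ hsS)
    obtain ⟨z, -, hz, -⟩ := hZ.exists_left_limit hφ hs0
    have hzs : z = Z s := by
      by_contra hne
      exact (hnj s hs0 z hz hne).2 hsS
    rw [hzs] at hz
    obtain ⟨hc, hη⟩ := exists_hasDerivAt_crossing h𝒳 hr hφ hρ hZ hs0 hz (hF _ hsS)
    exact ⟨⟨hs0, hsH⟩, hz, hc, (hS ▸ hsS : Z s ∈ {x ∈ 𝒳 | ρ x = 0}).2, hη⟩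
  -- at other times `ρ` stays away from zero
  have hoff : ∀ s ∈ Icc 0 H, Z s ∉ S → ∃ N ∈ 𝓝 s, ∃ ε > 0, ∀ t ∈ N, t ∈ Icc 0 H →
      ε < |ρ (Z t)| := by
    intro s hs hsS
    have hne : ∀ x ∈ 𝒳, x ∉ S → 0 < |ρ x| := fun x hx hxS =>
      abs_pos.2 fun hρx => hxS (by rw [hS]; exact ⟨hx, hρx⟩)
    have key : ∀ (l : Filter ℝ) (x : EuclideanSpace ℝ (Fin d)), x ∈ 𝒳 → x ∉ S →
        Tendsto Z l (𝓝 x) → ∃ ε > 0, ∀ᶠ t in l, ε < |ρ (Z t)| := by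
      intro l x hx hxS hl
      have hpos := hne x hx hxS
      exact ⟨|ρ x| / 2, half_pos hpos, ((hρ.continuous.abs.tendsto x).comp hl).eventually
        (lt_mem_nhds (half_lt_self hpos))⟩
    obtain ⟨ε₁, hε₁, h1⟩ := key (𝓝[≥] s) (Z s) (hZ.mem hφ hs.1) hsS
      (hZ.hasDerivWithinAt_Ici hφ hs.1).continuousWithinAt
    obtain ⟨ε₂, hε₂, h2⟩ : ∃ ε > 0, ∀ᶠ t in 𝓝[<] s, t ∈ Icc 0 H → ε < |ρ (Z t)| := by
      rcases hs.1.eq_or_lt with h | h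
      · refine ⟨1, one_pos, ?_⟩
        filter_upwards [self_mem_nhdsWithin] with t ht htI
        exact absurd htI.1 (not_le.2 (h ▸ ht))
      · obtain ⟨z, hz𝒳, hz, -⟩ := hZ.exists_left_limit hφ h
        have hzS : z ∉ S := by
          by_cases hzs : z = Z s
          · rwa [hzs]
          · exact (hnj s h z hz hzs).1
        obtain ⟨ε, hε, h'⟩ := key _ z hz𝒳 hzS hz
        exact ⟨ε, hε, h'.mono fun t ht _ => ht⟩
    refine ⟨{t | t ∈ Icc 0 H → min ε₁ ε₂ < |ρ (Z t)|}, ?_, min ε₁ ε₂, lt_min hε₁ hε₂,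
      fun t ht htI => ht htI⟩
    rw [← nhdsLT_sup_nhdsGE]
    refine ⟨?_, ?_⟩
    · exact h2.mono fun t ht htI => (min_le_right _ _).trans_lt (ht htI)
    · exact h1.mono fun t ht _ => (min_le_left _ _).trans_lt ht
  -- the times in `S` are isolated, hence finite in number
  have hfin : {s | s ∈ Icc 0 H ∧ Z s ∈ S}.Finite := by
    have := isCompact_Icc.induction_on (s := Icc 0 H)
      (p := fun A => (A ∩ {s | s ∈ Icc 0 H ∧ Z s ∈ S}).Finite) (by simp)
      (fun s t hst ht => ht.subset (inter_subset_inter_left _ hst))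
      (fun s t hs ht => by rw [union_inter_distrib_right]; exact hs.union ht) ?_
    · exact this.subset fun s hs => ⟨hs.1, hs⟩
    · intro s hs
      by_cases hsS : Z s ∈ S
      · obtain ⟨-, -, -, hρ0, η, hη, hd⟩ := hcross s hs hsS
        refine ⟨Ioo (s - η) (s + η), mem_nhdsWithin_of_mem_nhds
          (Ioo_mem_nhds (by linarith) (by linarith)), (finite_singleton s).subset ?_⟩
        rintro t ⟨ht, -, htS⟩
        by_contra hts
        rw [hS] at htS
        exact ne_zero_of_hasDerivAt_ne_zero hη hd hρ0 ht hts htS.2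
      · obtain ⟨N, hN, ε, hε, h⟩ := hoff s hs hsS
        refine ⟨N, mem_nhdsWithin_of_mem_nhds hN, Set.finite_empty.subset ?_⟩
        rintro t ⟨ht, htI, htS⟩
        rw [hS] at htS
        have := h t ht htI
        rw [htS.2, abs_zero] at this
        exact absurd this (not_lt.2 hε.le)
  have hset : {s | s ∈ Icc 0 H ∧ HasContinuousCrossing Z S s} = {s | s ∈ Icc 0 H ∧ Z s ∈ S} := by
    ext s
    refine ⟨fun h => ⟨h.1, h.2.2.2.1⟩, fun h => ⟨h.1, ?_⟩⟩
    obtain ⟨hs, hleft, -, hρ0, η, hη, hd⟩ := hcross s h.1 h.2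
    refine ⟨hs.1, hleft, h.2, η, hη, fun t ht hts htS => ?_⟩
    rw [hS] at htS
    exact ne_zero_of_hasDerivAt_ne_zero hη hd hρ0 ht hts htS.2
  have hcount : (crossingCount Z S H : ℝ≥0∞) = ∑ s ∈ hfin.toFinset, ENNReal.ofReal (χ (Z s)) := by
    have h1 : ∑ s ∈ hfin.toFinset, ENNReal.ofReal (χ (Z s)) = ∑ s ∈ hfin.toFinset, 1 := by
      refine Finset.sum_congr rfl fun s hs => ?_
      rw [hχ1 _ (hfin.mem_toFinset.1 hs).2, ENNReal.ofReal_one]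
    rw [h1, crossingCount, hset, hfin.encard_eq_coe_toFinset_card]
    simp
  rw [hcount]
  simp_rw [← lintegral_indicator measurableSet_Icc]
  refine tendsto_lintegral_of_concentrating (C := Icc 0 H) isCompact_Icc
    (fun δ t ht => indicator_of_notMem ht _) _ (fun s => ENNReal.ofReal (χ (Z s))) ?_ ?_
  · intro s hs
    rw [hfin.mem_toFinset] at hs
    obtain ⟨hs', -, hc, hρ0, η, hη, hd⟩ := hcross s hs.1 hs.2
    have hpos : 0 < min η (min s (H - s)) := lt_min hη (lt_min hs'.1 (sub_pos.2 hs'.2))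
    refine ⟨_, hpos, fun a ha haη => ?_⟩
    have ha1 := haη.trans (min_le_left _ _)
    have ha2 := (haη.trans (min_le_right _ _)).trans (min_le_left _ _)
    have ha3 := (haη.trans (min_le_right _ _)).trans (min_le_right _ _)
    have hsub : Ioo (s - a) (s + a) ⊆ Ioo (s - η) (s + η) :=
      Ioo_subset_Ioo (by linarith) (by linarith)
    have hsub' : Ioo (s - a) (s + a) ⊆ Icc 0 H :=
      fun t ht => ⟨by linarith [ht.1], by linarith [ht.2]⟩
    have := tendsto_lintegral_bandKernel (u := fun t => ρ (Z t))
      (w := fun t => ENNReal.ofReal (χ (Z t))) ha (fun t ht => (hd t (hsub ht)).1)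
      (fun t ht => (hd t (hsub ht)).2) hρ0
      (ENNReal.continuous_ofReal.continuousAt.comp (hχ.continuousAt.comp hc))
    refine this.congr fun δ => ?_
    exact setLIntegral_congr_fun measurableSet_Ioo fun t ht =>
      (indicator_of_mem (hsub' ht) (fun t => ENNReal.ofReal (χ (Z t)) *
        (ENNReal.ofReal |⟪gradient ρ (Z t), r (Z t)⟫| * bandKernel δ (ρ (Z t))))).symm
  · intro s hs hsF
    rw [hfin.mem_toFinset] at hsF
    obtain ⟨N, hN, ε, hε, h⟩ := hoff s hs fun hsS => hsF ⟨hs, hsS⟩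
    refine ⟨N, hN, ?_⟩
    filter_upwards [Ioo_mem_nhdsGT hε] with δ hδ t ht
    refine indicator_apply_eq_zero.2 fun htI => ?_
    rw [bandKernel_of_le (hδ.2.le.trans (h t ht htI).le)]; simp

/-- Uniformly over all trajectories, `ρ` is injective along the flow during a short time after a
visit to a compact set around which the flow is transversal to the level sets of `ρ`: the speed is
bounded near the compact set, so that the trajectory stays in the region of transversality. -/
lemma exists_time_rho_ne (hr : ContinuousOn r 𝒳) (hφ : IsFlowOf 𝒳 r φ)
    (hρ : ContDiff ℝ 1 ρ) {K U : Set (EuclideanSpace ℝ (Fin d))} (hK : IsCompact K)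
    (hU : IsOpen U) (hKU : K ⊆ U) (hU𝒳 : U ⊆ 𝒳) (hF : ∀ x ∈ U, ⟪gradient ρ x, r x⟫ ≠ 0) :
    ∃ τ > 0, ∀ ζ ∈ 𝒳, ∀ a b, a < b → b ≤ a + τ → φ ζ a ∈ K → ρ (φ ζ a) ≠ ρ (φ ζ b) := by
  obtain ⟨η, hη, hηU⟩ := hK.exists_cthickening_subset_open hU hKU
  obtain ⟨R, hR⟩ := hK.cthickening (r := η).exists_bound_of_continuousOn
    (hr.mono (hηU.trans hU𝒳))
  set R' := max R 0 + 1 with hR'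
  have hR'pos : 0 < R' := by positivity
  refine ⟨η / R', by positivity, fun ζ hζ a b hab hbτ haK heq => ?_⟩
  have hfence : ∀ s ∈ Icc a b, ‖φ ζ s - φ ζ a‖ ≤ R' * (s - a) := by
    refine image_norm_le_of_norm_deriv_right_lt_deriv_boundary (f' := fun s => r (φ ζ s))
      (B' := fun _ => R') ?_ ?_ (by simp) ?_ ?_
    · exact ((hφ.continuous hζ).sub continuous_const).continuousOn
    · exact fun s _ => ((hφ.hasDerivAt ζ hζ s).sub_const _).hasDerivWithinAt
    · exact fun s => by simpa using ((hasDerivAt_id s).sub_const a).const_mul R'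
    · intro s hs hsB
      have hsK : φ ζ s ∈ Metric.cthickening η K := by
        refine Metric.mem_cthickening_of_dist_le _ _ _ _ haK ?_
        rw [dist_eq_norm, hsB]
        calc R' * (s - a) ≤ R' * (η / R') := by
              gcongr; linarith [hs.2]
          _ = η := by field_simp
      calc ‖r (φ ζ s)‖ ≤ R := hR _ hsK
        _ ≤ max R 0 := le_max_left _ _
        _ < R' := lt_add_one _
  have hstay : ∀ s ∈ Icc a b, φ ζ s ∈ U := by
    intro s hs
    refine hηU (Metric.mem_cthickening_of_dist_le _ _ _ _ haK ?_)
    rw [dist_eq_norm]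
    calc _ ≤ R' * (s - a) := hfence s hs
      _ ≤ R' * (η / R') := by gcongr; linarith [hs.2]
      _ = η := by field_simp
  have hder : ∀ s, HasDerivAt (fun s => ρ (φ ζ s)) ⟪gradient ρ (φ ζ s), r (φ ζ s)⟫ s := fun s =>
    (hρ.hasGradientAt _).hasDerivAt_comp (hφ.hasDerivAt ζ hζ s)
  obtain ⟨c, hc, hc'⟩ := exists_hasDerivAt_eq_zero hab
    (fun x _ => (hder x).continuousAt.continuousWithinAt) heq (fun x _ => hder x)
  exact hF _ (hstay c (Ioo_subset_Icc_self hc)) hc'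

end Paths

/-! ### Sample paths of piecewise smooth processes -/

section SamplePaths

variable {Ω : Type*} {T : ℕ → Ω → ℝ} {ω : Ω}

/-- The properties of the jump times which hold almost surely for a marked point process. -/
structure IsGoodTimeSequence (T : ℕ → Ω → ℝ) (ω : Ω) : Prop where
  zero : T 0 ω = 0
  mono : Monotone fun n => T n ω
  tendsto : Tendsto (fun n => T n ω) atTop atTop

namespace IsGoodTimeSequence

lemma lastJumpIndex_spec (hT : IsGoodTimeSequence T ω) {t : ℝ} (ht : 0 ≤ t) :
    T (lastJumpIndex T t ω) ω ≤ t ∧ t < T (lastJumpIndex T t ω + 1) ω := by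
  have hne : {n : ℕ | T n ω ≤ t}.Nonempty := ⟨0, by change T 0 ω ≤ t; rw [hT.zero]; exact ht⟩
  obtain ⟨m, hm⟩ := (hT.tendsto.eventually_gt_atTop t).exists
  have hbdd : BddAbove {n : ℕ | T n ω ≤ t} := by
    refine ⟨m, fun n hn => ?_⟩
    by_contra hcon
    exact absurd (hm.trans_le (hT.mono (not_le.1 hcon).le)) (not_lt.2 hn)
  refine ⟨Nat.sSup_mem hne hbdd, ?_⟩
  by_contra hcon
  have : lastJumpIndex T t ω + 1 ≤ lastJumpIndex T t ω := le_csSup hbdd (not_lt.1 hcon)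
  omega

lemma lastJumpIndex_eq (hT : IsGoodTimeSequence T ω) {t : ℝ} (ht : 0 ≤ t) {n : ℕ}
    (h1 : T n ω ≤ t) (h2 : t < T (n + 1) ω) : lastJumpIndex T t ω = n := by
  obtain ⟨h3, h4⟩ := hT.lastJumpIndex_spec ht
  by_contra hne
  rcases lt_or_gt_of_ne hne with h | h
  · exact absurd (h4.trans_le ((hT.mono h).trans h1)) (lt_irrefl _)
  · exact absurd (h2.trans_le ((hT.mono h).trans h3)) (lt_irrefl _)

lemma nonneg (hT : IsGoodTimeSequence T ω) (n : ℕ) : 0 ≤ T n ω :=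
  hT.zero ▸ hT.mono (Nat.zero_le n)

variable {d : ℕ} {𝒳 : Set (EuclideanSpace ℝ (Fin d))}
  {r : EuclideanSpace ℝ (Fin d) → EuclideanSpace ℝ (Fin d)}
  {φ : EuclideanSpace ℝ (Fin d) → ℝ → EuclideanSpace ℝ (Fin d)}
  {ρ χ : EuclideanSpace ℝ (Fin d) → ℝ} {M : ℕ → Ω → EuclideanSpace ℝ (Fin d)}

lemma process_eq (hT : IsGoodTimeSequence T ω) {t : ℝ} {n : ℕ}
    (h1 : T n ω ≤ t) (h2 : t < T (n + 1) ω) :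
    piecewiseSmoothProcess φ T M t ω = φ (M n ω) (t - T n ω) := by
  rw [piecewiseSmoothProcess, hT.lastJumpIndex_eq ((hT.nonneg n).trans h1) h1 h2]

lemma followsFlow (hT : IsGoodTimeSequence T ω) (hM : ∀ n, M n ω ∈ 𝒳) :
    FollowsFlow 𝒳 φ (fun t => piecewiseSmoothProcess φ T M t ω) where
  right t ht := by
    obtain ⟨h1, h2⟩ := hT.lastJumpIndex_spec ht
    refine ⟨_, hM (lastJumpIndex T t ω), T (lastJumpIndex T t ω) ω, ?_⟩
    filter_upwards [Ico_mem_nhdsGE h2] with s hs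
    exact hT.process_eq (h1.trans hs.1) hs.2
  left t ht := by
    have hex : ∃ m, t ≤ T m ω := (hT.tendsto.eventually_ge_atTop t).exists
    classical
    obtain ⟨n, hn⟩ : ∃ n, Nat.find hex = n + 1 := by
      refine Nat.exists_eq_succ_of_ne_zero fun h0 => ?_
      have := Nat.find_spec hex
      rw [h0, hT.zero] at this
      exact absurd ht (not_lt.2 this)
    have h1 : T n ω < t := not_le.1 (Nat.find_min hex (by omega))
    have h2 : t ≤ T (n + 1) ω := hn ▸ Nat.find_spec hex
    refine ⟨_, hM n, T n ω, ?_⟩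
    filter_upwards [Ioo_mem_nhdsLT h1] with s hs
    exact hT.process_eq hs.1.le (hs.2.trans_le h2)

/-- The number of pieces of a path which meet `[0, H]` is at most one plus the number of jump
times. -/
lemma encard_pieces_le (hT : IsGoodTimeSequence T ω) (H : ℝ) :
    {n : ℕ | T n ω < T (n + 1) ω ∧ T n ω ≤ H}.encard ≤ jumpTimeCount T H ω + 1 := by
  set s := {n : ℕ | T n ω < T (n + 1) ω ∧ T n ω ≤ H}
  have hinj : InjOn (fun n => T n ω) s := by
    have main : ∀ m ∈ s, ∀ n, m < n → T m ω < T n ω := fun m hm n hmn =>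
      hm.1.trans_le (hT.mono hmn)
    intro m hm n hn hmn
    by_contra hne
    rcases lt_or_gt_of_ne hne with h | h
    · exact (main m hm n h).ne hmn
    · exact (main n hn m h).ne hmn.symm
  calc s.encard ≤ (s \ {0}).encard + ({0} : Set ℕ).encard := by
        refine (encard_le_encard ?_).trans (encard_union_le _ _)
        rw [sdiff_union_self]; exact subset_union_left
    _ ≤ jumpTimeCount T H ω + 1 := by
        rw [encard_singleton]
        gcongr
        rw [← (hinj.mono sdiff_subset).encard_image]
        refine encard_le_encard ?_
        rintro _ ⟨n, hn, rfl⟩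
        exact ⟨⟨hT.nonneg n, hn.1.2⟩, n, Nat.one_le_iff_ne_zero.2 hn.2, rfl⟩

/-- **Domination.** The smoothed crossing numbers of a path are bounded by a constant times one plus
the number of jump times: on each piece, and during each period shorter than the time given by
`exists_time_rho_ne`, the function `ρ` is injective along the visits of the path to the support
of `χ`. -/
lemma lintegral_smoothed_crossings_le (hT : IsGoodTimeSequence T ω) (hM : ∀ n, M n ω ∈ 𝒳)
    (hφ : IsFlowOf 𝒳 r φ) (hρ : ContDiff ℝ 1 ρ) (hχ1 : ∀ x, χ x ≤ 1) {τ : ℝ} (hτ : 0 < τ)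
    (hinj : ∀ ζ ∈ 𝒳, ∀ a b, a < b → b ≤ a + τ → φ ζ a ∈ tsupport χ → ρ (φ ζ a) ≠ ρ (φ ζ b))
    (H : ℝ) {δ : ℝ} (hδ : 0 < δ) :
    ∫⁻ t in Icc 0 H, ENNReal.ofReal (χ (piecewiseSmoothProcess φ T M t ω)) *
      (ENNReal.ofReal |⟪gradient ρ (piecewiseSmoothProcess φ T M t ω),
        r (piecewiseSmoothProcess φ T M t ω)⟫| *
      bandKernel δ (ρ (piecewiseSmoothProcess φ T M t ω))) ≤
    ((jumpTimeCount T H ω : ℝ≥0∞) + 1) * (⌊H / τ⌋₊ + 1 : ℕ) := by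
  set Z := fun t => piecewiseSmoothProcess φ T M t ω with hZ
  set g : EuclideanSpace ℝ (Fin d) → ℝ≥0∞ := fun x => ENNReal.ofReal (χ x) *
    (ENNReal.ofReal |⟪gradient ρ x, r x⟫| * bandKernel δ (ρ x)) with hg
  change ∫⁻ t in Icc 0 H, g (Z t) ≤ _
  have hg0 : ∀ x, x ∉ tsupport χ → g x = 0 := by
    intro x hx
    simp only [hg]
    rw [image_eq_zero_of_notMem_tsupport hx]; simp
  set P := {n : ℕ | T n ω < T (n + 1) ω ∧ T n ω ≤ H} with hP
  have hPfin : P.Finite := by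
    obtain ⟨m, hm⟩ := (hT.tendsto.eventually_gt_atTop H).exists
    refine (finite_Iio m).subset fun n hn => ?_
    by_contra hcon
    exact absurd (hm.trans_le (hT.mono (not_lt.1 hcon))) (not_lt.2 hn.2)
  let A : ℕ × ℕ → Set ℝ := fun q =>
    (Ico (T q.1 ω) (T (q.1 + 1) ω) ∩ Ico (T q.1 ω + q.2 * τ) (T q.1 ω + q.2 * τ + τ)) ∩
      (fun t => φ (M q.1 ω) (t - T q.1 ω)) ⁻¹' tsupport χ
  have hcont : ∀ n, Continuous fun t => φ (M n ω) (t - T n ω) := fun n =>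
    (hφ.continuous (hM n)).comp (continuous_id.sub continuous_const)
  have hAm : ∀ q, MeasurableSet (A q) := fun q =>
    (measurableSet_Ico.inter measurableSet_Ico).inter
      (((isClosed_tsupport χ).preimage (hcont q.1)).measurableSet)
  have hAint : ∀ q, ∫⁻ t in A q, g (Z t) ≤ 1 := by
    rintro ⟨n, k⟩
    have hder : ∀ t, HasDerivAt (fun t => ρ (φ (M n ω) (t - T n ω)))
        ⟪gradient ρ (φ (M n ω) (t - T n ω)), r (φ (M n ω) (t - T n ω))⟫ t := fun t =>
      (hρ.hasGradientAt _).hasDerivAt_comp (hφ.hasDerivAt_shift (hM n) _ t)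
    have hmain : ∀ a ∈ A (n, k), ∀ b ∈ A (n, k), a < b →
        ρ (φ (M n ω) (a - T n ω)) ≠ ρ (φ (M n ω) (b - T n ω)) := by
      intro a ha b hb hab
      refine hinj _ (hM n) _ _ (by linarith) ?_ ha.2
      have h1 := ha.1.2.1
      have h2 := hb.1.2.2
      dsimp only at h1 h2
      linarith
    have hinjOn : InjOn (fun t => ρ (φ (M n ω) (t - T n ω))) (A (n, k)) := by
      intro a ha b hb hab
      by_contra hne
      rcases lt_or_gt_of_ne hne with h | h
      · exact hmain a ha b hb h hab
      · exact hmain b hb a ha h hab.symm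
    refine le_trans ?_ (lintegral_abs_deriv_mul_bandKernel_le (hAm (n, k))
      (fun t _ => (hder t).hasDerivWithinAt) hinjOn hδ)
    refine setLIntegral_mono' (hAm (n, k)) fun t ht => ?_
    have hZt : Z t = φ (M n ω) (t - T n ω) := hT.process_eq ht.1.1.1 ht.1.1.2
    rw [hZt]
    calc _ ≤ 1 * _ := mul_le_mul_left (ENNReal.ofReal_le_one.2 (hχ1 _)) _
      _ = _ := one_mul _
  set s : Finset (ℕ × ℕ) := hPfin.toFinset ×ˢ Finset.range (⌊H / τ⌋₊ + 1) with hs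
  have hcover : ∀ t ∈ Icc 0 H, Z t ∈ tsupport χ → ∃ q ∈ s, t ∈ A q := by
    intro t ht htχ
    obtain ⟨h1, h2⟩ := hT.lastJumpIndex_spec ht.1
    set n := lastJumpIndex T t ω with hn
    have h0 := hT.nonneg n
    have hk1 := Nat.floor_le (div_nonneg (sub_nonneg.2 h1) hτ.le)
    have hk2 := Nat.lt_floor_add_one ((t - T n ω) / τ)
    rw [le_div_iff₀ hτ] at hk1
    rw [div_lt_iff₀ hτ] at hk2
    refine ⟨(n, ⌊(t - T n ω) / τ⌋₊), ?_, ⟨⟨⟨h1, h2⟩, ?_, ?_⟩, htχ⟩⟩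
    · rw [hs, Finset.mem_product, hPfin.mem_toFinset, Finset.mem_range, Nat.lt_succ_iff]
      refine ⟨⟨h1.trans_lt h2, h1.trans ht.2⟩, Nat.floor_le_floor ?_⟩
      gcongr
      linarith [ht.2]
    · dsimp only; linarith
    · dsimp only; linarith
  calc ∫⁻ t in Icc 0 H, g (Z t) ≤ ∫⁻ t in ⋃ q : s, A q, g (Z t) := by
        rw [← lintegral_indicator measurableSet_Icc,
          ← lintegral_indicator (MeasurableSet.iUnion fun q : s => hAm q)]
        refine lintegral_mono fun t => ?_
        refine indicator_apply_le' (fun ht => ?_) fun _ => zero_le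
        by_cases htχ : Z t ∈ tsupport χ
        · obtain ⟨q, hq, hqA⟩ := hcover t ht htχ
          rw [indicator_of_mem (mem_iUnion.2 ⟨⟨q, hq⟩, hqA⟩)]
        · rw [hg0 _ htχ]; exact zero_le
    _ ≤ ∑' q : s, ∫⁻ t in A q, g (Z t) := lintegral_iUnion_le _ _
    _ ≤ ∑' q : s, 1 := ENNReal.tsum_le_tsum fun q => hAint q
    _ = (hPfin.toFinset.card : ℝ≥0∞) * (⌊H / τ⌋₊ + 1 : ℕ) := by
        rw [tsum_fintype]
        simp [hs, Finset.card_product]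
    _ ≤ _ := by
        gcongr
        have h1 := hT.encard_pieces_le H
        rw [← hP, hPfin.encard_eq_coe_toFinset_card] at h1
        have h2 := ENat.toENNReal_le.2 h1
        simpa using h2

end IsGoodTimeSequence

end SamplePaths

/-! ### Expectations of time integrals of a stationary process -/

section Stationary

variable {Ω : Type*} [MeasurableSpace Ω] {P : Measure Ω} {d : ℕ}

/-- A process with almost surely right continuous paths has a jointly measurable modification,
obtained by discretizing time from the right. -/
lemma aemeasurable_process [SFinite P] {X : ℝ → Ω → EuclideanSpace ℝ (Fin d)}
    (hX : ∀ t, 0 ≤ t → AEMeasurable (X t) P)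
    (hrc : ∀ᵐ ω ∂P, ∀ t, 0 ≤ t → ContinuousWithinAt (fun s => X s ω) (Ici t) t) (H : ℝ) :
    AEMeasurable (fun q : Ω × ℝ => X q.2 q.1) (P.prod (volume.restrict (Icc 0 H))) := by
  have hs : ∀ n k : ℕ, (0 : ℝ) ≤ ((k : ℝ) + 1) / (n + 1) := fun n k => by positivity
  let Y : ℕ → ℕ → Ω → EuclideanSpace ℝ (Fin d) := fun n k => (hX _ (hs n k)).mk _
  have hYm : ∀ n k, Measurable (Y n k) := fun n k => (hX _ (hs n k)).measurable_mk
  have hYX : ∀ᵐ ω ∂P, ∀ n k : ℕ, X (((k : ℝ) + 1) / (n + 1)) ω = Y n k ω :=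
    ae_all_iff.2 fun n => ae_all_iff.2 fun k => (hX _ (hs n k)).ae_eq_mk
  refine aemeasurable_of_tendsto_metrizable_ae atTop
    (f := fun (n : ℕ) (q : Ω × ℝ) => Y n ⌊((n : ℝ) + 1) * q.2⌋₊ q.1) (fun n => ?_) ?_
  · have h1 : Measurable fun p : Ω × ℕ => Y n p.2 p.1 :=
      measurable_from_prod_countable_left fun k => hYm n k
    have h2 : Measurable fun q : Ω × ℝ => (q.1, ⌊((n : ℝ) + 1) * q.2⌋₊) :=
      measurable_fst.prodMk (Nat.measurable_floor.comp (measurable_snd.const_mul _))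
    exact (h1.comp h2).aemeasurable
  · filter_upwards [Measure.quasiMeasurePreserving_fst.ae (hYX.and hrc),
      Measure.quasiMeasurePreserving_snd.ae (ae_restrict_mem measurableSet_Icc)] with q hq hq2
    obtain ⟨ω, t⟩ := q
    have ht : 0 ≤ t := hq2.1
    -- the discretized times decrease to `t` from the right
    have hle : ∀ n : ℕ, t ≤ ((⌊((n : ℝ) + 1) * t⌋₊ : ℝ) + 1) / (n + 1) := fun n => by
      rw [le_div_iff₀ (by positivity), mul_comm]
      exact (Nat.lt_floor_add_one _).le
    have hge : ∀ n : ℕ, ((⌊((n : ℝ) + 1) * t⌋₊ : ℝ) + 1) / (n + 1) ≤ t + 1 / ((n : ℝ) + 1) := by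
      intro n
      have hfl := Nat.floor_le (show 0 ≤ ((n : ℝ) + 1) * t by positivity)
      have hn : (0 : ℝ) < (n : ℝ) + 1 := by positivity
      rw [div_le_iff₀ hn, add_mul t, one_div_mul_cancel hn.ne']
      linarith
    have hlim : Tendsto (fun n : ℕ => ((⌊((n : ℝ) + 1) * t⌋₊ : ℝ) + 1) / (n + 1)) atTop
        (𝓝[≥] t) := by
      refine tendsto_nhdsWithin_iff.2 ⟨?_, Eventually.of_forall hle⟩
      refine tendsto_of_tendsto_of_tendsto_of_le_of_le tendsto_const_nhds ?_ hle hge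
      simpa using tendsto_const_nhds.add (tendsto_one_div_add_atTop_nhds_zero_nat (𝕜 := ℝ))
    refine ((hq.2 t ht).tendsto.comp hlim).congr fun n => ?_
    exact hq.1 n _

lemma HasDensity.lintegral_comp {Z : Ω → EuclideanSpace ℝ (Fin d)}
    {q : EuclideanSpace ℝ (Fin d) → ℝ} (h : HasDensity P Z q)
    {g : EuclideanSpace ℝ (Fin d) → ℝ≥0∞} (hg : Measurable g) :
    ∫⁻ ω, g (Z ω) ∂P = ∫⁻ x, ENNReal.ofReal (q x) * g x := by
  rw [← lintegral_map' hg.aemeasurable h.aemeasurable, h.map_eq,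
    lintegral_withDensity_eq_lintegral_mul _ h.measurable.ennreal_ofReal hg]
  rfl

lemma HasDensity.ae_notMem {Z : Ω → EuclideanSpace ℝ (Fin d)}
    {q : EuclideanSpace ℝ (Fin d) → ℝ} (h : HasDensity P Z q) {S : Set (EuclideanSpace ℝ (Fin d))}
    (hS : volume S = 0) : ∀ᵐ ω ∂P, Z ω ∉ S := by
  refine ae_of_ae_map (p := fun x => x ∉ S) h.aemeasurable ?_
  rw [h.map_eq]
  exact (withDensity_absolutelyContinuous _ _).ae_le (measure_eq_zero_iff_ae_notMem.1 hS)

/-- For a process with stationary density, the expected time integral of `g (X t)` is the length of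
the interval times a space integral. -/
lemma lintegral_lintegral_stationary [SFinite P] {X : ℝ → Ω → EuclideanSpace ℝ (Fin d)}
    {q : EuclideanSpace ℝ (Fin d) → ℝ} (hq : IsStationaryDensity P X q) {H : ℝ}
    (hjm : AEMeasurable (fun q : Ω × ℝ => X q.2 q.1) (P.prod (volume.restrict (Icc 0 H))))
    {g : EuclideanSpace ℝ (Fin d) → ℝ≥0∞} (hg : Measurable g) :
    ∫⁻ ω, (∫⁻ t in Icc 0 H, g (X t ω)) ∂P =
      ENNReal.ofReal H * ∫⁻ x, ENNReal.ofReal (q x) * g x := by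
  rw [lintegral_lintegral_swap (f := fun ω t => g (X t ω)) (hg.comp_aemeasurable hjm),
    setLIntegral_congr_fun (g := fun _ => ∫⁻ x, ENNReal.ofReal (q x) * g x) measurableSet_Icc
      fun t ht => (hq t ht.1).lintegral_comp hg,
    setLIntegral_const, Real.volume_Icc, sub_zero, mul_comm]

end Stationary

/-! ### The hypersurface and its normal field -/

section Hypersurface

variable {d : ℕ} {𝒳 D : Set (EuclideanSpace ℝ (Fin d))} {ρ : EuclideanSpace ℝ (Fin d) → ℝ}

lemma IsDefiningFunction.frontier_eq (h : IsDefiningFunction 𝒳 D ρ) :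
    frontier D = {x ∈ 𝒳 | ρ x = 0} := by
  have hfr : frontier D = closure D \ D := h.isOpen.frontier_eq
  ext x
  constructor
  · intro hx
    have hx𝒳 := h.frontier_subset hx
    rw [hfr] at hx
    refine ⟨hx𝒳, le_antisymm ?_ ?_⟩
    · by_contra hcon
      have : x ∈ 𝒳 \ closure D := by rw [h.pos_iff]; exact ⟨hx𝒳, not_le.1 hcon⟩
      exact this.2 hx.1
    · by_contra hcon
      exact hx.2 (by rw [h.neg_iff]; exact ⟨hx𝒳, not_le.1 hcon⟩)
  · rintro ⟨hx𝒳, hx0⟩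
    rw [hfr]
    refine ⟨?_, fun hxD => ?_⟩
    · by_contra hcon
      have : x ∈ 𝒳 \ closure D := ⟨hx𝒳, hcon⟩
      rw [h.pos_iff] at this
      exact this.2.ne' hx0
    · rw [h.neg_iff] at hxD
      exact hxD.2.ne hx0

lemma IsDefiningFunction.isCompact_frontier (h : IsDefiningFunction 𝒳 D ρ) :
    IsCompact (frontier D) :=
  Metric.isCompact_of_isClosed_isBounded isClosed_frontier
    (h.isBounded.closure.subset frontier_subset_closure)

lemma abs_inner_unitNormal_mul_norm (ρ : EuclideanSpace ℝ (Fin d) → ℝ)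
    (v x : EuclideanSpace ℝ (Fin d)) :
    |⟪v, unitNormal ρ x⟫| * ‖gradient ρ x‖ = |⟪gradient ρ x, v⟫| := by
  rw [unitNormal, real_inner_smul_right, abs_mul, abs_inv, abs_norm, real_inner_comm]
  by_cases h : gradient ρ x = 0
  · simp [h]
  · field_simp [norm_ne_zero_iff.2 h]

end Hypersurface

lemma exists_cutoff {E : Type*} [TopologicalSpace E] [T2Space E] [LocallyCompactSpace E]
    {K U : Set E} (hK : IsCompact K) (hU : IsOpen U) (hKU : K ⊆ U) :
    ∃ χ : E → ℝ, Continuous χ ∧ HasCompactSupport χ ∧ tsupport χ ⊆ U ∧ (∀ x ∈ K, χ x = 1) ∧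
      ∀ x, χ x ∈ Icc (0 : ℝ) 1 := by
  obtain ⟨f, h1, h2, h3, h4⟩ := exists_continuous_sum_one_of_isOpen_isCompact
    (s := fun _ : Fin 1 => U) (fun _ => hU) hK (hKU.trans (subset_iUnion (fun _ : Fin 1 => U) 0))
  exact ⟨f 0, (f 0).continuous, h4 0, h1 0, fun x hx => by simpa using h2 hx, h3 0⟩

/-! ### The crossing formula -/

theorem mainTheorem8 {Ω : Type*} [MeasurableSpace Ω] (P : Measure Ω) [IsProbabilityMeasure P]
    (d : ℕ) (hd : 2 ≤ d)
    -- the state space, the vector field and its flow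
    (𝒳 : Set (EuclideanSpace ℝ (Fin d))) (h𝒳 : IsOpen 𝒳)
    (r : EuclideanSpace ℝ (Fin d) → EuclideanSpace ℝ (Fin d)) (hr : ContDiffOn ℝ 1 r 𝒳)
    (φ : EuclideanSpace ℝ (Fin d) → ℝ → EuclideanSpace ℝ (Fin d)) (hφ : IsFlowOf 𝒳 r φ)
    -- the jump times and marks, with finitely many expected jumps in bounded intervals
    (T : ℕ → Ω → ℝ) (M : ℕ → Ω → EuclideanSpace ℝ (Fin d))
    (hTM : IsMarkedPointProcess P 𝒳 T M)
    (hjump : ∀ u : ℝ, ∫⁻ ω, (jumpTimeCount T u ω : ℝ≥0∞) ∂P < ⊤)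
    -- the piecewise smooth process and its densities
    (X : ℝ → Ω → EuclideanSpace ℝ (Fin d)) (hX : X = piecewiseSmoothProcess φ T M)
    (p : ℝ → EuclideanSpace ℝ (Fin d) → ℝ)
    (hp : ∀ t : ℝ, 0 ≤ t → HasDensity P (X t) (p t))
    -- the hypersurface
    (D S : Set (EuclideanSpace ℝ (Fin d))) (ρ : EuclideanSpace ℝ (Fin d) → ℝ)
    (hD : IsDefiningFunction 𝒳 D ρ) (hS : S = frontier D)
    -- the time horizon
    (H : ℝ) (hH : 0 ≤ H)
    -- the flow is not tangent to the hypersurface, and crosses it boundedly often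
    (hnt : ∀ x ∈ S, ⟪r x, unitNormal ρ x⟫ ≠ 0)
    (hsup : (⨆ x ∈ 𝒳, crossingCount (φ x) S H) < ⊤)
    -- almost surely, no jumps from or to the hypersurface
    (hnojump : ∀ᵐ ω ∂P, NoJumpFromOrTo (fun t => X t ω) S)
    -- the densities are jointly continuous near the hypersurface
    (hcont : ∃ V : Set (EuclideanSpace ℝ (Fin d)), IsOpen V ∧ S ⊆ V ∧
      ContinuousOn (fun q : EuclideanSpace ℝ (Fin d) × ℝ => p q.2 q.1) (V ×ˢ Icc 0 H))
    -- stationarity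
    (hstat : IsStationaryDensity P X (p 0)) :
    AEMeasurable (fun ω => (crossingCount (fun t => X t ω) S H : ℝ≥0∞)) P ∧
    IntegrableOn (fun x => |⟪r x, unitNormal ρ x⟫| * p 0 x) S
      (Measure.euclideanHausdorffMeasure (d - 1)) ∧
    ∫⁻ ω, (crossingCount (fun t => X t ω) S H : ℝ≥0∞) ∂P =
      ENNReal.ofReal (H * ∫ x in S, |⟪r x, unitNormal ρ x⟫| * p 0 x
        ∂(Measure.euclideanHausdorffMeasure (d - 1))) := by
  have hρ := hD.contDiff
  have hS0 : S = {x ∈ 𝒳 | ρ x = 0} := hS.trans hD.frontier_eq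
  have hScomp : IsCompact S := hS ▸ hD.isCompact_frontier
  have hdim : Module.finrank ℝ (EuclideanSpace ℝ (Fin d)) = (d - 1) + 1 := by
    rw [finrank_euclideanSpace_fin]; omega
  obtain ⟨V, hV, hSV, hpV⟩ := hcont
  have hp0V : ContinuousOn (p 0) V := by
    have : ContinuousOn (fun x : EuclideanSpace ℝ (Fin d) => (x, (0 : ℝ))) V := by fun_prop
    exact hpV.comp this fun x hx => ⟨hx, left_mem_Icc.2 hH⟩
  have hF𝒳 : ContinuousOn (fun x => ⟪gradient ρ x, r x⟫) 𝒳 :=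
    hρ.continuous_gradient.continuousOn.inner hr.continuousOn
  -- the region around `S` where the flow is transversal to the level sets of `ρ`
  set U := (𝒳 ∩ (fun x => ⟪gradient ρ x, r x⟫) ⁻¹' {0}ᶜ) ∩ V with hU
  have hUo : IsOpen U := (hF𝒳.isOpen_inter_preimage h𝒳 isOpen_compl_singleton).inter hV
  have hUF : ∀ x ∈ U, ⟪gradient ρ x, r x⟫ ≠ 0 := fun x hx => hx.1.2
  have hUg : ∀ x ∈ U, gradient ρ x ≠ 0 := fun x hx h0 => hUF x hx (by rw [h0, inner_zero_left])
  have hFS : ∀ x ∈ S, ⟪gradient ρ x, r x⟫ ≠ 0 := by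
    intro x hx h0
    have h1 := abs_inner_unitNormal_mul_norm ρ (r x) x
    rw [h0, abs_zero] at h1
    exact mul_ne_zero (abs_ne_zero.2 (hnt x hx))
      (norm_ne_zero_iff.2 (hD.gradient_ne_zero x (hS ▸ hx))) h1
  have hSU : S ⊆ U := fun x hx => ⟨⟨(hS0 ▸ hx : x ∈ {x ∈ 𝒳 | ρ x = 0}).1, hFS x hx⟩, hSV hx⟩
  obtain ⟨χ, hχc, hχs, hχU, hχ1, hχ01⟩ := exists_cutoff hScomp hUo hSU
  -- the surface integrand, cut off away from `S`
  set h : EuclideanSpace ℝ (Fin d) → ℝ :=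
    fun x => χ x * (|⟪r x, unitNormal ρ x⟫| * p 0 x) with hh
  have hh0 : ∀ x, 0 ≤ h x := fun x =>
    mul_nonneg (hχ01 x).1 (mul_nonneg (abs_nonneg _) ((hp 0 le_rfl).nonneg x))
  have hhts : tsupport h ⊆ tsupport χ := tsupport_mul_subset_left
  have hhc : Continuous h := by
    refine continuous_of_tsupport fun x hx => ?_
    have hxU := hχU (hhts hx)
    have hg : ContinuousAt (gradient ρ) x := hρ.continuous_gradient.continuousAt
    have hν : ContinuousAt (unitNormal ρ) x :=
      (hg.norm.inv₀ (norm_ne_zero_iff.2 (hUg x hxU))).smul hg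
    have hrx : ContinuousAt r x := hr.continuousOn.continuousAt (h𝒳.mem_nhds hxU.1.1)
    exact hχc.continuousAt.mul ((hrx.inner hν).abs.mul (hp0V.continuousAt (hV.mem_nhds hxU.2)))
  have hhs : HasCompactSupport h := hχs.mul_right
  -- surface integrals only see `S`
  have hrestr : ∀ f : EuclideanSpace ℝ (Fin d) → ℝ, (∀ x, χ x = 0 → f x = 0) →
      ∫⁻ x in {x | ρ x = 0}, ENNReal.ofReal (f x) ∂μHE[d - 1] =
      ∫⁻ x in S, ENNReal.ofReal (f x) ∂μHE[d - 1] := by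
    intro f hf
    rw [← lintegral_indicator (isClosed_eq hρ.continuous continuous_const).measurableSet,
      ← lintegral_indicator hScomp.measurableSet]
    refine lintegral_congr fun x => ?_
    by_cases hx : x ∈ 𝒳
    · simp [indicator, hS0, hx]
    · have : χ x = 0 := image_eq_zero_of_notMem_tsupport fun hcon => hx (hχU hcon).1.1
      simp [indicator, hf x this]
  have hcoarea := tendsto_band_integral hdim hρ hhc hhs fun x hx _ => hUg x (hχU (hhts hx))
  rw [hrestr h fun x hx => by simp [hh, hx]] at hcoarea
  -- `S` has finite surface measure, hence zero volume
  have hSvol : volume S = 0 := by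
    have h1 := (tendsto_band_integral hdim hρ hχc hχs fun x hx _ => hUg x (hχU hx)).2
    rw [hrestr χ fun x hx => hx, setLIntegral_congr_fun (g := fun _ => 1) hScomp.measurableSet
      fun x hx => by simp [hχ1 x hx], setLIntegral_const, one_mul] at h1
    have h2 := Measure.euclideanHausdorffMeasure_zero_or_top (show d - 1 < d by omega) S
    rw [EuclideanSpace.euclideanHausdorffMeasure_eq_volume] at h2
    exact h2.resolve_right h1
  -- the smoothed crossing numbers
  set g : ℝ → EuclideanSpace ℝ (Fin d) → ℝ≥0∞ := fun δ x => ENNReal.ofReal (χ x) *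
    (ENNReal.ofReal |⟪gradient ρ x, r x⟫| * bandKernel δ (ρ x)) with hg
  have hgm : ∀ δ, Measurable (g δ) := by
    intro δ
    have hc : Continuous fun x => χ x * |⟪gradient ρ x, r x⟫| :=
      continuous_of_tsupport fun x hx => hχc.continuousAt.mul (hF𝒳.continuousAt
        (h𝒳.mem_nhds (hχU (tsupport_mul_subset_left hx)).1.1)).abs
    have heq : g δ = fun x => ENNReal.ofReal (χ x * |⟪gradient ρ x, r x⟫|) *
        bandKernel δ (ρ x) := by
      funext x
      rw [hg, ENNReal.ofReal_mul (hχ01 x).1, mul_assoc]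
    rw [heq]
    exact hc.measurable.ennreal_ofReal.mul
      ((measurable_bandKernel δ).comp hρ.continuous.measurable)
  have hgood : ∀ᵐ ω ∂P, IsGoodTimeSequence T ω := by
    filter_upwards [hTM.time_zero, hTM.time_mono, hTM.time_tendsto] with ω h1 h2 h3
    exact ⟨h1, h2, h3⟩
  have hM : ∀ ω n, M n ω ∈ 𝒳 := fun ω n => hTM.mark_mem n ω
  have hXZ : ∀ t ω, X t ω = piecewiseSmoothProcess φ T M t ω := fun t ω => by rw [hX]
  have hfollow : ∀ᵐ ω ∂P, FollowsFlow 𝒳 φ (fun t => X t ω) := by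
    filter_upwards [hgood] with ω hω
    simp_rw [hXZ]
    exact hω.followsFlow (hM ω)
  have hjm : AEMeasurable (fun q : Ω × ℝ => X q.2 q.1) (P.prod (volume.restrict (Icc 0 H))) := by
    refine aemeasurable_process (fun t ht => (hp t ht).aemeasurable) ?_ H
    filter_upwards [hfollow] with ω hω t ht
    exact (hω.hasDerivWithinAt_Ici hφ ht).continuousWithinAt
  set N : ℝ → Ω → ℝ≥0∞ := fun δ ω => ∫⁻ t in Icc 0 H, g δ (X t ω) with hN
  have hNm : ∀ δ, AEMeasurable (N δ) P := fun δ =>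
    ((hgm δ).comp_aemeasurable hjm).lintegral_prod_right'
  have hNlim : ∀ᵐ ω ∂P, Tendsto (fun δ => N δ ω) (𝓝[>] 0)
      (𝓝 (crossingCount (fun t => X t ω) S H : ℝ≥0∞)) := by
    filter_upwards [hfollow, hnojump, (hp 0 le_rfl).ae_notMem hSvol, (hp H hH).ae_notMem hSvol]
      with ω h1 h2 h3 h4
    exact tendsto_crossingCount h𝒳 hr.continuousOn hφ hρ hS0 hFS hχc hχ1 h1 h2 h3 h4
  obtain ⟨τ, hτ, hinj⟩ := exists_time_rho_ne hr.continuousOn hφ hρ hχs.isCompact hUo hχU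
    (fun x hx => hx.1.1) hUF
  have hdom : ∀ᶠ δ in 𝓝[>] (0 : ℝ), ∀ᵐ ω ∂P,
      N δ ω ≤ ((jumpTimeCount T H ω : ℝ≥0∞) + 1) * (⌊H / τ⌋₊ + 1 : ℕ) := by
    filter_upwards [self_mem_nhdsWithin] with δ hδ
    filter_upwards [hgood] with ω hω
    simp only [hN, hg, hXZ]
    exact hω.lintegral_smoothed_crossings_le (hM ω) hφ hρ (fun x => (hχ01 x).2) hτ hinj H hδ
  have hdomfin : ∫⁻ ω, ((jumpTimeCount T H ω : ℝ≥0∞) + 1) * (⌊H / τ⌋₊ + 1 : ℕ) ∂P ≠ ⊤ := by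
    rw [lintegral_mul_const' _ _ (ENNReal.natCast_ne_top _),
      lintegral_add_right _ measurable_const, lintegral_const]
    exact ENNReal.mul_ne_top (ENNReal.add_ne_top.2 ⟨(hjump H).ne, by simp⟩)
      (ENNReal.natCast_ne_top _)
  -- the expected smoothed crossing numbers converge to both sides of the formula
  have hlim1 : Tendsto (fun δ => ∫⁻ ω, N δ ω ∂P) (𝓝[>] 0)
      (𝓝 (∫⁻ ω, (crossingCount (fun t => X t ω) S H : ℝ≥0∞) ∂P)) :=
    tendsto_lintegral_filter_of_dominated_convergence' _ (Eventually.of_forall hNm) hdom hdomfin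
      hNlim
  have hlim2 : Tendsto (fun δ => ∫⁻ ω, N δ ω ∂P) (𝓝[>] 0)
      (𝓝 (ENNReal.ofReal H * ∫⁻ x in S, ENNReal.ofReal (h x) ∂μHE[d - 1])) := by
    refine (ENNReal.Tendsto.const_mul hcoarea.1 (Or.inr ENNReal.ofReal_ne_top)).congr fun δ => ?_
    rw [hN, lintegral_lintegral_stationary hstat hjm (hgm δ)]
    congr 1
    refine lintegral_congr fun x => ?_
    simp only [hg, hh]
    rw [← abs_inner_unitNormal_mul_norm, ENNReal.ofReal_mul (hχ01 x).1,
      ENNReal.ofReal_mul (abs_nonneg _), ENNReal.ofReal_mul (abs_nonneg _)]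
    ring
  have hEq := tendsto_nhds_unique hlim1 hlim2
  have hhS : EqOn h (fun x => |⟪r x, unitNormal ρ x⟫| * p 0 x) S := fun x hx => by
    simp [hh, hχ1 x hx]
  have hhint : IntegrableOn h S μHE[d - 1] :=
    ⟨hhc.aestronglyMeasurable, (hasFiniteIntegral_iff_ofReal (ae_of_all _ hh0)).2
      (lt_top_iff_ne_top.2 hcoarea.2)⟩
  refine ⟨?_, hhint.congr_fun hhS hScomp.measurableSet, ?_⟩
  · exact aemeasurable_of_tendsto_metrizable_ae (𝓝[>] (0 : ℝ)) hNm hNlim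
  · rw [hEq, ← setIntegral_congr_fun hScomp.measurableSet hhS, ENNReal.ofReal_mul hH,
      ofReal_integral_eq_lintegral_ofReal hhint (ae_of_all _ hh0)]
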